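/- Write $\mathcal W$ for planar Brownian motion started at $x\in\mathbb R^2$, normalized so that its generator is the Laplacian $\partial_1^2+\partial_2^2$ (each coordinate of $\mathcal W_t$ has variance $2t$, and the free transition density is $e^{-|x-y|^2/4t}/(4\pi t)$). For an open set $\Omega\subset\mathbb R^2$, a finite set $\Sigma\subset\Omega^{\mathsf c}$, a point $x\in\Omega$ and $t>0$, let $T_\Omega$ be the first exit time of $\mathcal W$ from $\Omega$. On the event $T_\Omega>t$ let $W_\Sigma(\mathcal W;t)=\sum_{\sigma\in\Sigma}W_\sigma(\mathcal W;t)$, where $2\pi W_\sigma(\mathcal W;t)$ is the total increment over $[0,t]$ of a continuous determination of the angle of $\mathcal W_s-\sigma$. The diagonal Dirichlet heat kernel of $\Omega$ with monodromy $-1$ around each point of $\Sigma$ is $$P^{\mathrm D}_{\Omega,\Sigma}(x,x;t)=\lim_{r\to0^+}\frac1{\pi r^2}\,\mathbb E_x\!\left[\mathbf 1_{\{|\mathcal W_t-x|\le r\}}\,\mathbf 1_{\{T_\Omega>t\}}\,e^{i\pi W_\Sigma(\mathcal W;t)}\right].$$ **Theorem.** These limits exist, and there is a constant $C>0$ such that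 for all open sets $\Omega,\Theta\subset\mathbb R^2$, all finite sets $\Sigma_1\subset\Omega^{\mathsf c}$ and $\Sigma_2\subset\Theta^{\mathsf c}$, all $x\in\Omega\cap\Theta$ and all $t>0$, $$\left|P^{\mathrm D}_{\Omega,\Sigma_1}(x,x;t)-P^{\mathrm D}_{\Theta,\Sigma_2}(x,x;t)\right|\le\frac Ct\exp\!\left(-\frac{R^2}{8t}\right),\qquad R=\operatorname{dist}\bigl(x,(\Theta\triangle\Omega)\cup(\Sigma_1\triangle\Sigma_2)\bigr),$$ where the distance to the empty set is $+\infty$ and the right-hand side is then $0$. -/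

import Mathlib

open MeasureTheory ProbabilityTheory Filter Topology
open scoped NNReal ENNReal

noncomputable section

/-- Brownian motion in the Euclidean plane, identified with `ℂ`, started at `x`, in the
normalization for which the generator is the Laplacian `∂₁² + ∂₂²` (so that `exp (-t Δ)`, with `Δ`
the positive Laplacian, is its transition semigroup): the real and imaginary parts of
`(W - x) / √2` are independent standard real Brownian motions. In particular each coordinate of
`W t` has variance `2 t`, and the transition density is `exp (-|x - y|² / 4t) / (4 π t)`. -/
structure IsPlanarBrownian {X : Type*} [MeasurableSpace X]
    (W : ℝ≥0 → X → ℂ) (x : ℂ) (P : Measure X) : Prop where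
  re : IsBrownianReal (fun s ω => ((W s ω).re - x.re) / Real.sqrt 2) P
  im : IsBrownianReal (fun s ω => ((W s ω).im - x.im) / Real.sqrt 2) P
  indep : IndepFun (fun ω s => (W s ω).re) (fun ω s => (W s ω).im) P

/-- First exit time of the path `γ` from the set `Ω` (`∞` if it never leaves). -/
def exitTime (γ : ℝ≥0 → ℂ) (Ω : Set ℂ) : ℝ≥0∞ :=
  ⨅ (s : ℝ≥0) (_ : γ s ∉ Ω), (s : ℝ≥0∞)

open Classical in
/-- The (real-valued) winding number of the path `γ` around `σ` up to time `t`: the total increment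
over `[0, t]` of a continuous determination of the angle of `γ s - σ`, divided by `2 π`. The angle
is the imaginary part of a continuous logarithm `ℓ` of `γ s - σ`. When there is none (that is, if
`γ` is discontinuous or hits `σ` before time `t`), the value is `0`. -/
def windingNumber (γ : ℝ≥0 → ℂ) (σ : ℂ) (t : ℝ≥0) : ℝ :=
  if h : ∃ ℓ : ℝ≥0 → ℂ, ContinuousOn ℓ (Set.Iic t) ∧ ∀ s ≤ t, Complex.exp (ℓ s) = γ s - σ then
    (h.choose t - h.choose 0).im / (2 * Real.pi)
  else 0

/-- The winding number does not depend on the continuous logarithm used to compute it. -/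
theorem windingNumber_eq {γ : ℝ≥0 → ℂ} {σ : ℂ} {t : ℝ≥0} {ℓ : ℝ≥0 → ℂ}
    (hc : ContinuousOn ℓ (Set.Iic t)) (hℓ : ∀ s ≤ t, Complex.exp (ℓ s) = γ s - σ) :
    windingNumber γ σ t = (ℓ t - ℓ 0).im / (2 * Real.pi) := by
  have h : ∃ ℓ : ℝ≥0 → ℂ, ContinuousOn ℓ (Set.Iic t) ∧
      ∀ s ≤ t, Complex.exp (ℓ s) = γ s - σ := ⟨ℓ, hc, hℓ⟩
  rw [windingNumber, dif_pos h]
  obtain ⟨hc', hℓ'⟩ := h.choose_spec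
  set m := h.choose
  have hp : IsPreconnected (Set.Iic t) := Set.ordConnected_Iic.isPreconnected
  have key : ∀ s ∈ Set.Iic t, ∃ n : ℤ, m s - ℓ s = n * (2 * Real.pi * Complex.I) := by
    intro s hs
    obtain ⟨n, hn⟩ := Complex.exp_eq_exp_iff_exists_int.1 ((hℓ' s hs).trans (hℓ s hs).symm)
    exact ⟨n, by rw [hn]; ring⟩
  have hpi : (2 * Real.pi * Complex.I : ℂ) ≠ 0 := Complex.two_pi_I_ne_zero
  choose! n hn using key
  have hcn : ContinuousOn (fun s => ((n s : ℤ) : ℝ)) (Set.Iic t) := by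
    have h1 : ContinuousOn (fun s => ((m s - ℓ s) / (2 * Real.pi * Complex.I)).re) (Set.Iic t) :=
      Complex.continuous_re.comp_continuousOn ((hc'.sub hc).div_const _)
    refine h1.congr fun s hs => ?_
    simp only [hn s hs]
    rw [mul_div_assoc, div_self hpi]
    simp
  have hcz : ContinuousOn n (Set.Iic t) :=
    Int.isClosedEmbedding_coe_real.isEmbedding.continuousOn_iff.2 hcn
  have e : n t = n 0 := hp.constant hcz (Set.mem_Iic.2 le_rfl) (Set.mem_Iic.2 (zero_le))
  have e1 := hn t (Set.mem_Iic.2 le_rfl)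
  have e2 := hn 0 (Set.mem_Iic.2 (zero_le))
  have : m t - m 0 = ℓ t - ℓ 0 := by
    rw [e] at e1
    linear_combination e1 - e2
  rw [this]

/-- Total winding number around the points of a finite set `S`. -/
def totalWinding (γ : ℝ≥0 → ℂ) (S : Finset ℂ) (t : ℝ≥0) : ℝ :=
  ∑ σ ∈ S, windingNumber γ σ t

open Classical in
/-- The average of the heat kernel over the disk of radius `r` about the starting point `x`,
`(π r²)⁻¹ 𝔼ₓ[𝟙(|W_t - x| ≤ r) 𝟙(t < T_Ω) exp (i π W_S)]`, where `T_Ω` is the exit time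
from `Ω` and `W_S` the total winding number around the points of `S` up to time `t`. -/
def heatKernelAverage {X : Type*} [MeasurableSpace X] (W : ℝ≥0 → X → ℂ) (P : Measure X)
    (Ω : Set ℂ) (S : Finset ℂ) (x : ℂ) (t : ℝ≥0) (r : ℝ) : ℂ :=
  (1 / (Real.pi * r ^ 2) : ℝ) *
    ∫ ω, (if ‖W t ω - x‖ ≤ r ∧ (t : ℝ≥0∞) < exitTime (fun s => W s ω) Ω then
      Complex.exp (Complex.I * Real.pi * totalWinding (fun s => W s ω) S t) else 0) ∂P

/-- The diagonal Dirichlet heat kernel `P^D_{Ω,S}(x, x; t)` of the domain `Ω` with monodromy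
`-1` around each point of `S`, in terms of Brownian motion `W` started at `x`: the limit of
`heatKernelAverage` as the radius tends to `0`. -/
def dirichletHeatKernelDiag {X : Type*} [MeasurableSpace X] (W : ℝ≥0 → X → ℂ) (P : Measure X)
    (Ω : Set ℂ) (S : Finset ℂ) (x : ℂ) (t : ℝ≥0) : ℂ :=
  limUnder (𝓝[>] (0 : ℝ)) (heatKernelAverage W P Ω S x t)

/-- `exp (-d² / 8t)` for a distance `d ∈ [0, ∞]`, with value `0` at `d = ∞`. -/
def gaussianFactor (d : ℝ≥0∞) (t : ℝ) : ℝ :=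
  if d = ⊤ then 0 else Real.exp (-d.toReal ^ 2 / (8 * t))

end

/-! Both kernels are averages of a bounded path functional (`pathPhase`) over Brownian paths that
return to a small disk of radius `r` about `x`. Inside a disk that misses the marked points the
angle has a single-valued branch, so there a stretch of path contributes to the monodromy only
through its endpoints, via `halfAnglePhase`, which tends to `1` at `x`.

Comparison: if a path stays within distance `R` of `x` up to time `t`, it stays in `Ω` exactly when
it stays in `Θ`. The common marked points then give the same monodromy, and each remaining one gives
a factor depending only on `W t`, which tends to `1` as `r → 0`. Hence only paths leaving the disk
matter. If the excursion happens in `[0, t/2]`, the maximal inequality bounds its probability, and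
the independent increment over `[t/2, t]` supplies the factor of order `r² / t` for landing near
`x`. If it happens in `[t/2, t]`, time reversal reduces it to the first case. Dividing by `π r²`
leaves `(C / t) exp (-R² / 8t)`.

Existence of the limit: stopping at time `t - v` leaves a functional of the past times a Gaussian
increment with continuous density, and such averages converge (`tendsto_average_pathSample`). For
small `v` the functional at time `t` is close to one of this form unless the path leaves a small
disk during `[t - v, t]`, which reversal and the maximal inequality make unlikely. So the averages
are Cauchy.

Measurability is obtained by expressing the functional through countably many sampled values of the
path (`exists_measurable_pathPhase_eq`). -/

/-! ### Deterministic paths: exit times, continuous logarithms, winding numbers. -/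

theorem lt_exitTime_iff {γ : ℝ≥0 → ℂ} (hγ : Continuous γ) {Ω : Set ℂ} (hΩ : IsOpen Ω) (t : ℝ≥0) :
    (t : ℝ≥0∞) < exitTime γ Ω ↔ ∀ s ≤ t, γ s ∈ Ω := by
  constructor
  · intro h s hs
    by_contra hn
    have : exitTime γ Ω ≤ s := iInf₂_le s hn
    exact absurd (h.trans_le this) (by simpa using hs)
  · intro h
    have ht : γ ⁻¹' Ω ∈ 𝓝 t := (hΩ.preimage hγ).mem_nhds (h t le_rfl)
    -- Openness of `Ω` keeps the path inside a little beyond `t`, which makes the infimum strictly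
    -- larger than `t`.
    obtain ⟨v, hv, hsub⟩ := exists_Ico_subset_of_mem_nhds ht ⟨t + 1, by simp⟩
    refine lt_of_lt_of_le (ENNReal.coe_lt_coe.2 hv) (le_iInf₂ fun s hs => ?_)
    by_contra hlt
    rw [not_le, ENNReal.coe_lt_coe] at hlt
    rcases le_total s t with h' | h'
    · exact hs (h s h')
    · exact hs (hsub ⟨h', hlt⟩)

theorem exists_continuous_log {γ : ℝ≥0 → ℂ} (hγ : Continuous γ) {σ : ℂ} {t : ℝ≥0}
    (h : ∀ s ≤ t, γ s ≠ σ) :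
    ∃ ℓ : ℝ≥0 → ℂ, Continuous ℓ ∧ ∀ s ≤ t, Complex.exp (ℓ s) = γ s - σ := by
  -- The path is extended to all of `ℝ` by freezing it outside `[0, t]`, and then lifted through the
  -- covering `exp : ℂ → ℂ \ {0}`.
  let f : C(ℝ, {z : ℂ // z ≠ 0}) :=
    ⟨fun a => ⟨γ (min a.toNNReal t) - σ, sub_ne_zero.2 (h _ (min_le_right _ _))⟩, by fun_prop⟩
  obtain ⟨F, ⟨-, hF⟩, -⟩ := Complex.isCoveringMap_exp.existsUnique_continuousMap_lifts f 0
    (Complex.log (f 0)) (Subtype.ext (Complex.exp_log (f 0).2))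
  refine ⟨fun s => F s, by fun_prop, fun s hs => ?_⟩
  have := congrArg Subtype.val (congrFun hF (s : ℝ))
  simpa [f, hs] using this

/-- The values of a path at the nonnegative rational times, stopped at time `u`. -/
def pathSample (u : ℝ≥0) (γ : ℝ≥0 → ℂ) (q : ℚ≥0) : ℂ := γ (min (q : ℝ≥0) u)

theorem NNReal.denseRange_nnratCast : DenseRange ((↑) : ℚ≥0 → ℝ≥0) := by
  refine dense_of_exists_between fun a b hab => ?_
  obtain ⟨q, hq0, h1, h2⟩ := (NNReal.lt_iff_exists_rat_btwn a b).1 hab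
  refine ⟨_, Set.mem_range_self q.toNNRat, ?_⟩
  have e : ((q.toNNRat : ℚ≥0) : ℝ≥0) = (q : ℝ).toNNReal := by
    ext
    rw [Real.coe_toNNReal _ (by exact_mod_cast hq0)]
    have h3 : ((q.toNNRat : ℚ≥0) : ℚ) = q := Rat.coe_toNNRat q hq0
    have h4 : (((q.toNNRat : ℚ≥0) : ℝ≥0) : ℝ) = (((q.toNNRat : ℚ≥0) : ℚ) : ℝ) := by
      norm_cast
    rw [h4, h3]
  rw [e]
  exact ⟨h1, h2⟩

/-- Closed conditions pass from a dense set of times to all times; this is how statements about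
samples return to paths. -/
theorem mem_of_pathSample_mem {γ : ℝ≥0 → ℂ} (hγ : Continuous γ) {K : Set ℂ} (hK : IsClosed K)
    {u : ℝ≥0} (h : ∀ q, pathSample u γ q ∈ K) {s : ℝ≥0} (hs : s ≤ u) : γ s ∈ K := by
  have hc : IsClosed {s : ℝ≥0 | γ (min s u) ∈ K} := hK.preimage (by fun_prop)
  have : γ (min s u) ∈ K := NNReal.denseRange_nnratCast.induction_on s hc h
  rwa [min_eq_left hs] at this

/-- Sampling is stopped at `u`, so the endpoint is itself a coordinate of the sample even when `u`
is irrational. -/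
theorem pathSample_ceil (u : ℝ≥0) (γ : ℝ≥0 → ℂ) : pathSample u γ (⌈u⌉₊ : ℚ≥0) = γ u := by
  simp [pathSample, Nat.le_ceil]

/-- A branch of the angle of `z - σ`, normalized to vanish at `z = x`. -/
noncomputable def angleFrom (x σ z : ℂ) : ℝ := Complex.arg ((z - σ) / (x - σ))

theorem div_mem_slitPlane {x σ z : ℂ} (h : ‖z - x‖ < ‖x - σ‖) :
    (z - σ) / (x - σ) ∈ Complex.slitPlane := by
  have h0 : x - σ ≠ 0 := norm_pos_iff.1 ((norm_nonneg _).trans_lt h)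
  refine Or.inl ?_
  have e : (z - σ) / (x - σ) = 1 + (z - x) / (x - σ) := by field_simp; ring
  have h1 : ‖(z - x) / (x - σ)‖ < 1 := by
    rw [norm_div, div_lt_one (norm_pos_iff.2 h0)]
    exact h
  have h2 := (abs_le.1 (Complex.abs_re_le_norm ((z - x) / (x - σ)))).1
  rw [e, Complex.add_re, Complex.one_re]
  linarith

/-- On a disk about `x` not containing `σ`, the principal logarithm of `(z - σ) / (x - σ)` is
continuous. It differs from any continuous logarithm along the path by a constant, since the
difference is continuous with values in a translate of the discrete set `2πiℤ`. -/
theorem windingNumber_sub {γ : ℝ≥0 → ℂ} (hγ : Continuous γ) {σ x : ℂ} {u t : ℝ≥0} (hut : u ≤ t)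
    (h : ∀ s ≤ t, γ s ≠ σ) (hx : ∀ s ∈ Set.Icc u t, ‖γ s - x‖ < ‖x - σ‖) :
    windingNumber γ σ t - windingNumber γ σ u =
      (angleFrom x σ (γ t) - angleFrom x σ (γ u)) / (2 * Real.pi) := by
  obtain ⟨ℓ, hc, hℓ⟩ := exists_continuous_log hγ h
  rw [windingNumber_eq hc.continuousOn hℓ,
    windingNumber_eq (t := u) hc.continuousOn fun s hs => hℓ s (hs.trans hut)]
  have hxσ : x - σ ≠ 0 :=
    norm_pos_iff.1 ((norm_nonneg _).trans_lt (hx u (Set.left_mem_Icc.2 hut)))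
  set m : ℝ≥0 → ℂ := fun s => Complex.log ((γ s - σ) / (x - σ)) with hm
  have hmc : ContinuousOn m (Set.Icc u t) := by
    refine ContinuousOn.clog (by fun_prop) fun s hs => div_mem_slitPlane (hx s hs)
  have key : ∀ s ∈ Set.Icc u t, ∃ n : ℤ,
      m s - (ℓ s - Complex.log (x - σ)) = n * (2 * Real.pi * Complex.I) := by
    intro s hs
    have h1 : Complex.exp (m s) = Complex.exp (ℓ s - Complex.log (x - σ)) := by
      rw [hm, Complex.exp_log, Complex.exp_sub, hℓ s hs.2, Complex.exp_log hxσ]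
      exact div_ne_zero (sub_ne_zero.2 (h s hs.2)) hxσ
    obtain ⟨n, hn⟩ := Complex.exp_eq_exp_iff_exists_int.1 h1
    exact ⟨n, by rw [hn]; ring⟩
  have hpi : (2 * Real.pi * Complex.I : ℂ) ≠ 0 := Complex.two_pi_I_ne_zero
  choose! n hn using key
  have hcn : ContinuousOn (fun s => ((n s : ℤ) : ℝ)) (Set.Icc u t) := by
    have h1 : ContinuousOn (fun s => ((m s - (ℓ s - Complex.log (x - σ))) /
        (2 * Real.pi * Complex.I)).re) (Set.Icc u t) :=
      Complex.continuous_re.comp_continuousOn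
        ((hmc.sub (hc.continuousOn.sub continuousOn_const)).div_const _)
    refine h1.congr fun s hs => ?_
    simp only [hn s hs]
    rw [mul_div_assoc, div_self hpi]
    simp
  have hcz : ContinuousOn n (Set.Icc u t) :=
    Int.isClosedEmbedding_coe_real.isEmbedding.continuousOn_iff.2 hcn
  have e : n t = n u := Set.ordConnected_Icc.isPreconnected.constant hcz
    (Set.right_mem_Icc.2 hut) (Set.left_mem_Icc.2 hut)
  have e1 := hn t (Set.right_mem_Icc.2 hut)
  have e2 := hn u (Set.left_mem_Icc.2 hut)
  have e3 : m t - m u = ℓ t - ℓ u := by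
    rw [e] at e1
    linear_combination e1 - e2
  have e4 := congrArg Complex.im e3
  simp only [hm, Complex.sub_im, Complex.log_im] at e4
  simp only [angleFrom, Complex.sub_im]
  rw [e4]
  ring

/-- The factor `exp (i ∑ angle / 2)` picked up inside a disk about `x` that misses `S`. -/
noncomputable def halfAnglePhase (S : Finset ℂ) (x z : ℂ) : ℂ :=
  Complex.exp (Complex.I / 2 * ((∑ σ ∈ S, angleFrom x σ z : ℝ) : ℂ))

theorem norm_halfAnglePhase (S : Finset ℂ) (x z : ℂ) : ‖halfAnglePhase S x z‖ = 1 := by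
  rw [halfAnglePhase, show Complex.I / 2 * ((∑ σ ∈ S, angleFrom x σ z : ℝ) : ℂ) =
    (((∑ σ ∈ S, angleFrom x σ z) / 2 : ℝ) : ℂ) * Complex.I by push_cast; ring]
  exact Complex.norm_exp_ofReal_mul_I _

theorem measurable_halfAnglePhase (S : Finset ℂ) (x : ℂ) : Measurable (halfAnglePhase S x) := by
  unfold halfAnglePhase angleFrom
  fun_prop

theorem halfAnglePhase_self (S : Finset ℂ) (x : ℂ) : halfAnglePhase S x x = 1 := by
  have h : ∀ σ ∈ S, angleFrom x σ x = 0 := by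
    intro σ _
    by_cases hσ : x - σ = 0
    · simp [angleFrom, hσ]
    · simp [angleFrom, div_self hσ]
  simp [halfAnglePhase, Finset.sum_eq_zero h]

theorem tendsto_halfAnglePhase {S : Finset ℂ} {x : ℂ} (hx : x ∉ S) :
    Tendsto (halfAnglePhase S x) (𝓝 x) (𝓝 1) := by
  have h : ContinuousAt (halfAnglePhase S x) x := by
    have h1 : ∀ σ ∈ S, ContinuousAt (angleFrom x σ) x := by
      intro σ hσ
      have hxσ : x - σ ≠ 0 := sub_ne_zero.2 fun h => hx (h ▸ hσ)
      refine ContinuousAt.comp (g := Complex.arg) (Complex.continuousAt_arg ?_) (by fun_prop)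
      exact div_mem_slitPlane (by simpa using norm_pos_iff.2 hxσ)
    have h2 : ContinuousAt (fun z => ∑ σ ∈ S, angleFrom x σ z) x :=
      tendsto_finsetSum _ h1
    unfold halfAnglePhase
    fun_prop
  rw [← halfAnglePhase_self S x]
  exact h

theorem exp_totalWinding_eq {γ : ℝ≥0 → ℂ} (hγ : Continuous γ) {S : Finset ℂ} {x : ℂ} {u t : ℝ≥0}
    (hut : u ≤ t) (h : ∀ σ ∈ S, ∀ s ≤ t, γ s ≠ σ)
    (hx : ∀ σ ∈ S, ∀ s ∈ Set.Icc u t, ‖γ s - x‖ < ‖x - σ‖) :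
    Complex.exp (Complex.I * Real.pi * totalWinding γ S t) =
      Complex.exp (Complex.I * Real.pi * totalWinding γ S u) *
        (halfAnglePhase S x (γ t) / halfAnglePhase S x (γ u)) := by
  have e : totalWinding γ S t = totalWinding γ S u + ((∑ σ ∈ S, angleFrom x σ (γ t)) -
      ∑ σ ∈ S, angleFrom x σ (γ u)) / (2 * Real.pi) := by
    rw [← Finset.sum_sub_distrib, Finset.sum_div, totalWinding, totalWinding,
      ← Finset.sum_add_distrib]
    refine Finset.sum_congr rfl fun σ hσ => ?_
    rw [← windingNumber_sub hγ hut (h σ hσ) (hx σ hσ)]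
    ring
  rw [e, halfAnglePhase, halfAnglePhase, ← Complex.exp_sub, ← Complex.exp_add]
  congr 1
  have hpi : (Real.pi : ℂ) ≠ 0 := by exact_mod_cast Real.pi_ne_zero
  push_cast
  field_simp

theorem totalWinding_zero (γ : ℝ≥0 → ℂ) (S : Finset ℂ) : totalWinding γ S 0 = 0 := by
  refine Finset.sum_eq_zero fun σ _ => ?_
  unfold windingNumber
  split_ifs <;> simp

open Classical in
/-- The indicator that `γ` stays in `Ω` up to time `t`, times its monodromy about `S`. -/
noncomputable def pathPhase (Ω : Set ℂ) (S : Finset ℂ) (t : ℝ≥0) (γ : ℝ≥0 → ℂ) : ℂ :=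
  if ∀ s ≤ t, γ s ∈ Ω then Complex.exp (Complex.I * Real.pi * totalWinding γ S t) else 0

theorem norm_exp_totalWinding (γ : ℝ≥0 → ℂ) (S : Finset ℂ) (t : ℝ≥0) :
    ‖Complex.exp (Complex.I * Real.pi * totalWinding γ S t)‖ = 1 := by
  rw [show Complex.I * Real.pi * totalWinding γ S t =
    ((Real.pi * totalWinding γ S t : ℝ) : ℂ) * Complex.I by push_cast; ring]
  exact Complex.norm_exp_ofReal_mul_I _

theorem norm_pathPhase_le (Ω : Set ℂ) (S : Finset ℂ) (t : ℝ≥0) (γ : ℝ≥0 → ℂ) :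
    ‖pathPhase Ω S t γ‖ ≤ 1 := by
  unfold pathPhase
  split_ifs
  · exact (norm_exp_totalWinding γ S t).le
  · simp

/-! ### The phase as a measurable function of the sampled path -/

/-- On a fine enough grid the continuous logarithm varies by less than `π` per step, so the
principal argument of each quotient is the exact angle increment and the sum telescopes. The winding
number is thus a limit of measurable functions of the samples. -/
theorem eventually_sum_arg_eq {γ : ℝ≥0 → ℂ} (hγ : Continuous γ) {σ : ℂ} {u : ℝ≥0}
    (h : ∀ s ≤ u, γ s ≠ σ) :
    ∀ᶠ n : ℕ in atTop, ∑ k ∈ Finset.range ((n + 1) ^ 2),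
      Complex.arg ((pathSample u γ ((k + 1 : ℕ) / (n + 1 : ℕ)) - σ) /
        (pathSample u γ ((k : ℕ) / (n + 1 : ℕ)) - σ)) = 2 * Real.pi * windingNumber γ σ u := by
  obtain ⟨ℓ, hc, hℓ⟩ := exists_continuous_log hγ h
  rw [windingNumber_eq hc.continuousOn hℓ]
  have huc : UniformContinuousOn ℓ (Set.Icc 0 u) :=
    isCompact_Icc.uniformContinuousOn_of_continuous hc.continuousOn
  obtain ⟨δ, hδ, hδ'⟩ := Metric.uniformContinuousOn_iff.1 huc Real.pi Real.pi_pos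
  have h1 : ∀ᶠ n : ℕ in atTop, 1 / ((n : ℝ) + 1) < δ :=
    tendsto_one_div_add_atTop_nhds_zero_nat.eventually (gt_mem_nhds hδ)
  -- The grid has `(n + 1)²` steps of length `1 / (n + 1)`, so it ends at `n + 1 ≥ u`; grid points
  -- past `u` are stopped there and contribute nothing.
  filter_upwards [h1, eventually_ge_atTop ⌈u⌉₊] with n hn hnu
  set τ : ℕ → ℝ≥0 := fun k => min (((k : ℕ) : ℝ≥0) / ((n + 1 : ℕ) : ℝ≥0)) u with hτ
  have hs : ∀ k : ℕ, pathSample u γ ((k : ℕ) / (n + 1 : ℕ)) = γ (τ k) := by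
    intro k
    simp [pathSample, hτ]
  have hτu : ∀ k, τ k ≤ u := fun k => min_le_right _ _
  have hd : ∀ k, dist (τ (k + 1)) (τ k) < δ := by
    intro k
    refine lt_of_le_of_lt ?_ hn
    have hb : dist (((k + 1 : ℕ) : ℝ≥0) / ((n + 1 : ℕ) : ℝ≥0)) (((k : ℕ) : ℝ≥0) / ((n + 1 : ℕ) : ℝ≥0))
        = 1 / ((n : ℝ) + 1) := by
      rw [NNReal.dist_eq]
      push_cast
      rw [← sub_div, add_sub_cancel_left, abs_of_nonneg (by positivity)]
    rw [← hb]
    rw [NNReal.dist_eq, NNReal.dist_eq]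
    simp only [hτ, NNReal.coe_min]
    exact (abs_min_sub_min_le_max _ _ _ _).trans (by simp)
  have ha : ∀ k ∈ Finset.range ((n + 1) ^ 2),
      Complex.arg ((pathSample u γ ((k + 1 : ℕ) / (n + 1 : ℕ)) - σ) /
        (pathSample u γ ((k : ℕ) / (n + 1 : ℕ)) - σ)) = (ℓ (τ (k + 1))).im - (ℓ (τ k)).im := by
    intro k _
    rw [hs, hs, ← hℓ _ (hτu _), ← hℓ _ (hτu _), ← Complex.exp_sub, ← Complex.log_im]
    have hlt := hδ' _ ⟨zero_le, hτu (k + 1)⟩ _ ⟨zero_le, hτu k⟩ (hd k)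
    rw [dist_eq_norm] at hlt
    have h3 := abs_lt.1 ((Complex.abs_im_le_norm _).trans_lt hlt)
    rw [Complex.log_exp h3.1 h3.2.le, Complex.sub_im]
  rw [Finset.sum_congr rfl ha, Finset.sum_range_sub (fun k => (ℓ (τ k)).im)]
  have e0 : τ 0 = 0 := by simp [hτ]
  have e1 : τ ((n + 1) ^ 2) = u := by
    simp only [hτ]
    refine min_eq_right ?_
    have : ((((n + 1) ^ 2 : ℕ) : ℝ≥0) / ((n + 1 : ℕ) : ℝ≥0)) = (n : ℝ≥0) + 1 := by
      push_cast
      field_simp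
    rw [this]
    refine (Nat.le_ceil u).trans ?_
    have : ((⌈u⌉₊ : ℕ) : ℝ≥0) ≤ n := by exact_mod_cast hnu
    exact this.trans (by simp)
  rw [e0, e1, Complex.sub_im]
  field_simp

theorem exists_measurable_pathPhase_eq {Ω : Set ℂ} (hΩ : IsOpen Ω) {S : Finset ℂ}
    (hS : (S : Set ℂ) ⊆ Ωᶜ) (u : ℝ≥0) :
    ∃ Φ : (ℚ≥0 → ℂ) → ℂ, Measurable Φ ∧ (∀ p, ‖Φ p‖ ≤ 1) ∧
      ∀ γ : ℝ≥0 → ℂ, Continuous γ → Φ (pathSample u γ) = pathPhase Ω S u γ := by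
  classical
  -- Samples lying in `Ω` would not suffice, since the path could touch the complement between them.
  -- By compactness a path inside `Ω` stays at positive distance from `Ωᶜ`, and each such bound is a
  -- closed condition.
  let D : Set (ℚ≥0 → ℂ) := ⋃ m : ℕ, ⋂ q, {p | ((m : ℝ≥0∞) + 1)⁻¹ ≤ Metric.infEDist (p q) Ωᶜ}
  have hD : MeasurableSet D := by
    refine MeasurableSet.iUnion fun m => MeasurableSet.iInter fun q => ?_
    exact measurableSet_le measurable_const (measurable_infEDist.comp (measurable_pi_apply q))
  have hDγ : ∀ γ : ℝ≥0 → ℂ, Continuous γ → (pathSample u γ ∈ D ↔ ∀ s ≤ u, γ s ∈ Ω) := by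
    intro γ hγ
    simp only [D, Set.mem_iUnion, Set.mem_iInter, Set.mem_ofPred_eq]
    constructor
    · rintro ⟨m, hm⟩ s hs
      have hK : IsClosed {z : ℂ | ((m : ℝ≥0∞) + 1)⁻¹ ≤ Metric.infEDist z Ωᶜ} :=
        isClosed_le continuous_const Metric.continuous_infEDist
      have h1 := mem_of_pathSample_mem hγ hK hm hs
      by_contra hn
      rw [Set.mem_ofPred_eq, Metric.infEDist_zero_of_mem (show γ s ∈ Ωᶜ from hn)] at h1
      simp at h1
    · intro h
      have hc : IsCompact (γ '' Set.Icc 0 u) := isCompact_Icc.image hγ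
      obtain ⟨δ, hδ, hsub⟩ := hc.exists_thickening_subset_open hΩ (by
        rintro _ ⟨s, hs, rfl⟩
        exact h s hs.2)
      obtain ⟨m, hm⟩ := exists_nat_one_div_lt hδ
      refine ⟨m, fun q => ?_⟩
      rw [Metric.le_infEDist]
      intro y hy
      by_contra hlt
      rw [not_le] at hlt
      refine hy (hsub (Metric.mem_thickening_iff.2
        ⟨pathSample u γ q, ⟨_, ⟨zero_le, min_le_right _ _⟩, rfl⟩, ?_⟩))
      refine lt_trans ?_ hm
      rw [dist_comm]
      have e : ((m : ℝ≥0∞) + 1)⁻¹ = ENNReal.ofReal (1 / ((m : ℝ) + 1)) := by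
        rw [one_div, ENNReal.ofReal_inv_of_pos (by positivity), ENNReal.ofReal_add (by positivity)
          zero_le_one]
        simp
      rw [e, edist_dist] at hlt
      exact (ENNReal.ofReal_lt_ofReal_iff (by positivity)).1 hlt
  let Ψ : ℕ → (ℚ≥0 → ℂ) → ℂ := fun n p => Complex.exp (Complex.I / 2 *
    ((∑ σ ∈ S, ∑ k ∈ Finset.range ((n + 1) ^ 2), Complex.arg ((p ((k + 1 : ℕ) / (n + 1 : ℕ)) - σ) /
        (p ((k : ℕ) / (n + 1 : ℕ)) - σ)) : ℝ) : ℂ))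
  have hΨ : ∀ n, Measurable (Ψ n) := by
    intro n
    simp only [Ψ]
    fun_prop
  let Φ₀ : (ℚ≥0 → ℂ) → ℂ := fun p => if p ∈ D then limUnder atTop (fun n => Ψ n p) else 0
  have hΦ₀ : Measurable Φ₀ :=
    Measurable.ite hD (StronglyMeasurable.limUnder fun n => (hΨ n).stronglyMeasurable).measurable
      measurable_const
  -- On samples of no continuous path `limUnder` may be arbitrary; truncation forces the bound
  -- everywhere without changing values on genuine paths.
  refine ⟨fun p => if ‖Φ₀ p‖ ≤ 1 then Φ₀ p else 0,
    Measurable.ite (measurableSet_le hΦ₀.norm measurable_const) hΦ₀ measurable_const,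
    fun p => ?_, fun γ hγ => ?_⟩
  · dsimp only
    split_ifs with h
    · exact h
    · simp
  · have key : Φ₀ (pathSample u γ) = pathPhase Ω S u γ := by
      by_cases hin : ∀ s ≤ u, γ s ∈ Ω
      · simp only [Φ₀, pathPhase, if_pos ((hDγ γ hγ).2 hin), if_pos hin]
        refine Tendsto.limUnder_eq (tendsto_const_nhds.congr' ?_)
        have hav : ∀ σ ∈ S, ∀ s ≤ u, γ s ≠ σ := fun σ hσ s hs e => hS hσ (e ▸ hin s hs)
        have hall := (Finset.eventually_all S).2 fun σ hσ => eventually_sum_arg_eq hγ (hav σ hσ)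
        filter_upwards [hall] with n hn
        simp only [Ψ]
        rw [Finset.sum_congr rfl hn, totalWinding, ← Finset.mul_sum]
        congr 1
        push_cast
        ring
      · simp only [Φ₀, pathPhase, if_neg hin, if_neg (mt (hDγ γ hγ).1 hin)]
    simp only [key, norm_pathPhase_le, if_true]

/-! ### Independence of past and increment, and time reversal. -/

/-- The hypotheses turn the joint law into a product of four laws, which may be regrouped. It
converts a splitting by coordinates (real, imaginary) into one by time (past, increment). -/
theorem ProbabilityTheory.IndepFun.prodMk_prodMk_comm {X α₁ α₂ β₁ β₂ : Type*} [MeasurableSpace X]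
    [MeasurableSpace α₁] [MeasurableSpace α₂] [MeasurableSpace β₁] [MeasurableSpace β₂]
    {P : Measure X} [IsProbabilityMeasure P] {a₁ : X → α₁} {a₂ : X → α₂} {b₁ : X → β₁} {b₂ : X → β₂}
    (ha₁ : AEMeasurable a₁ P) (ha₂ : AEMeasurable a₂ P) (hb₁ : AEMeasurable b₁ P)
    (hb₂ : AEMeasurable b₂ P) (h : IndepFun (fun ω => (a₁ ω, b₁ ω)) (fun ω => (a₂ ω, b₂ ω)) P)
    (h₁ : IndepFun a₁ b₁ P) (h₂ : IndepFun a₂ b₂ P) (ha : IndepFun a₁ a₂ P)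
    (hb : IndepFun b₁ b₂ P) :
    IndepFun (fun ω => (a₁ ω, a₂ ω)) (fun ω => (b₁ ω, b₂ ω)) P := by
  rw [indepFun_iff_map_prod_eq_prod_map_map (by fun_prop) (by fun_prop)] at h h₁ h₂ ha hb ⊢
  rw [h₁, h₂] at h
  rw [ha, hb]
  set A₁ := P.map a₁
  set A₂ := P.map a₂
  set B₁ := P.map b₁
  set B₂ := P.map b₂
  have : IsProbabilityMeasure A₁ := Measure.isProbabilityMeasure_map ha₁
  have : IsProbabilityMeasure A₂ := Measure.isProbabilityMeasure_map ha₂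
  have : IsProbabilityMeasure B₁ := Measure.isProbabilityMeasure_map hb₁
  have : IsProbabilityMeasure B₂ := Measure.isProbabilityMeasure_map hb₂
  have m1 := measurePreserving_prodAssoc A₁ B₁ (A₂.prod B₂)
  have m2 := ((measurePreserving_prodAssoc B₁ A₂ B₂).symm)
  have m3 := (Measure.measurePreserving_swap (μ := B₁) (ν := A₂)).prod (MeasurePreserving.id B₂)
  have m4 := measurePreserving_prodAssoc A₂ B₁ B₂
  have m5 := (measurePreserving_prodAssoc A₁ A₂ (B₁.prod B₂)).symm
  have m6 := m5.comp (((MeasurePreserving.id A₁).prod (m4.comp (m3.comp m2))).comp m1)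
  rw [← m6.map_eq, ← h, AEMeasurable.map_map_of_aemeasurable m6.measurable.aemeasurable
    (by fun_prop)]
  rfl

/-- For `s ≤ t` this is the reversed path `B t - B (t - s)`; for `s ≥ t` truncated subtraction gives
`B s - B 0`, so the process is defined for all times. It is centred Gaussian with covariance `min s
r`. -/
theorem ProbabilityTheory.IsBrownianReal.reverse {X : Type*} [MeasurableSpace X] {P : Measure X}
    {B : ℝ≥0 → X → ℝ} (hB : IsBrownianReal B P) (t : ℝ≥0) :
    IsBrownianReal (fun s ω => B (max s t) ω - B (t - s) ω) P where
  toIsPreBrownianReal := by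
    have hprob : IsProbabilityMeasure P := hB.isGaussianProcess.isProbabilityMeasure
    have hL : ∀ s, MemLp (fun ω => B s ω) 2 P :=
      fun s => (hB.isGaussianProcess.hasGaussianLaw_eval s).memLp_two
    refine IsGaussianProcess.isPreBrownianReal_of_covariance ?_ (fun s => ?_) fun s r hsr => ?_
    · exact hB.isGaussianProcess.of_isGaussianProcess fun s => ⟨{max s t, t - s},
        { toFun x := x ⟨max s t, by simp⟩ - x ⟨t - s, by simp⟩
          map_add' x y := by simp; abel
          map_smul' c x := by simp; ring }, by simp⟩
    · rw [integral_sub (hB.integrable_eval _) (hB.integrable_eval _), hB.integral_eval,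
        hB.integral_eval, sub_zero]
    · rw [covariance_fun_sub_fun_sub (hL _) (hL _) (hL _) (hL _)]
      simp_rw [hB.covariance_fun_eval]
      have e1 : min (max s t) (max r t) = max s t := min_eq_left (max_le_max_right t hsr)
      have e2 : min (max s t) (t - r) = t - r := min_eq_right (tsub_le_self.trans (le_max_right _ _))
      have e3 : min (t - s) (max r t) = t - s := min_eq_left (tsub_le_self.trans (le_max_right _ _))
      have e4 : min (t - s) (t - r) = t - r := min_eq_right (tsub_le_tsub_left hsr t)
      rw [e1, e2, e3, e4]
      rcases le_total s t with h | h
      · rw [max_eq_right h, NNReal.coe_sub h]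
        ring
      · rw [max_eq_left h, tsub_eq_zero_of_le h]
        simp
  cont := by
    filter_upwards [hB.cont] with ω h
    fun_prop

section
variable {X : Type*} [MeasurableSpace X] {P : Measure X} {W : ℝ≥0 → X → ℂ} {x : ℂ}

namespace IsPlanarBrownian

theorem isProbabilityMeasure (hW : IsPlanarBrownian W x P) : IsProbabilityMeasure P :=
  hW.re.isGaussianProcess.isProbabilityMeasure

theorem aemeasurable_re (hW : IsPlanarBrownian W x P) (s : ℝ≥0) :
    AEMeasurable (fun ω => (W s ω).re) P := by
  have h := ((hW.re.aemeasurable s).const_mul √2).add_const x.re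
  refine h.congr (Eventually.of_forall fun ω => ?_)
  dsimp only
  field_simp
  ring

theorem aemeasurable_im (hW : IsPlanarBrownian W x P) (s : ℝ≥0) :
    AEMeasurable (fun ω => (W s ω).im) P := by
  have h := ((hW.im.aemeasurable s).const_mul √2).add_const x.im
  refine h.congr (Eventually.of_forall fun ω => ?_)
  dsimp only
  field_simp
  ring

theorem aemeasurable (hW : IsPlanarBrownian W x P) (s : ℝ≥0) : AEMeasurable (W s) P := by
  have h1 := hW.aemeasurable_re s
  have h2 := hW.aemeasurable_im s
  have h : AEMeasurable (fun ω => ((W s ω).re : ℂ) + (W s ω).im * Complex.I) P := by fun_prop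
  simpa only [Complex.re_add_im] using h

theorem aemeasurable_pathSample (hW : IsPlanarBrownian W x P) (u : ℝ≥0) :
    AEMeasurable (fun ω => pathSample u (fun s => W s ω)) P :=
  aemeasurable_pi_lambda _ fun _ => hW.aemeasurable _

theorem continuous_ae (hW : IsPlanarBrownian W x P) : ∀ᵐ ω ∂P, Continuous fun s => W s ω := by
  filter_upwards [hW.re.cont, hW.im.cont] with ω h1 h2
  have h : Continuous fun s => ((√2 * (((W s ω).re - x.re) / √2) + x.re : ℝ) : ℂ) +
      ((√2 * (((W s ω).im - x.im) / √2) + x.im : ℝ) : ℂ) * Complex.I := by fun_prop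
  refine h.congr fun s => ?_
  rw [mul_div_cancel₀ _ (by positivity), mul_div_cancel₀ _ (by positivity), sub_add_cancel,
    sub_add_cancel, Complex.re_add_im]

theorem zero_ae (hW : IsPlanarBrownian W x P) : ∀ᵐ ω ∂P, W 0 ω = x := by
  filter_upwards [hW.re.eval_zero_ae_eq_zero, hW.im.eval_zero_ae_eq_zero] with ω h1 h2
  have h0 : √2 ≠ 0 := by positivity
  refine Complex.ext ?_ ?_
  · simpa [h0, sub_eq_zero] using h1
  · simpa [h0, sub_eq_zero] using h2

theorem reverse (hW : IsPlanarBrownian W x P) (t : ℝ≥0) :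
    IsPlanarBrownian (fun s ω => x + W (max s t) ω - W (t - s) ω) x P where
  re := by
    convert hW.re.reverse t using 3
    simp only [Complex.sub_re, Complex.add_re]
    ring
  im := by
    convert hW.im.reverse t using 3
    simp only [Complex.sub_im, Complex.add_im]
    ring
  indep := by
    have h := hW.indep.comp
      (φ := fun f : ℝ≥0 → ℝ => fun s : ℝ≥0 => x.re + f (max s t) - f (t - s))
      (ψ := fun f : ℝ≥0 → ℝ => fun s : ℝ≥0 => x.im + f (max s t) - f (t - s))
      (by fun_prop) (by fun_prop)
    exact h

theorem indepFun_pathSample (hW : IsPlanarBrownian W x P) {u t : ℝ≥0} (hut : u ≤ t) :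
    IndepFun (fun ω => pathSample u (fun s => W s ω)) (fun ω => W t ω - W u ω) P := by
  have := hW.isProbabilityMeasure
  have hr := fun s => hW.aemeasurable_re s
  have hi := fun s => hW.aemeasurable_im s
  have h : IndepFun
      (fun ω => (fun q : ℚ≥0 => (W (min (q : ℝ≥0) u) ω).re, (W t ω).re - (W u ω).re))
      (fun ω => (fun q : ℚ≥0 => (W (min (q : ℝ≥0) u) ω).im, (W t ω).im - (W u ω).im)) P :=
    hW.indep.comp
      (φ := fun f : ℝ≥0 → ℝ => (fun q : ℚ≥0 => f (min (q : ℝ≥0) u), f t - f u))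
      (ψ := fun f : ℝ≥0 → ℝ => (fun q : ℚ≥0 => f (min (q : ℝ≥0) u), f t - f u))
      (by fun_prop) (by fun_prop)
  have hs : ∀ (Z : ℝ≥0 → X → ℝ) (c : ℝ), IsBrownianReal (fun s ω => (Z s ω - c) / √2) P →
      IndepFun (fun ω => fun q : ℚ≥0 => Z (min (q : ℝ≥0) u) ω) (fun ω => Z t ω - Z u ω) P := by
    intro Z c hZ
    have h := ((hZ.indepFun_shift u).symm).comp
      (φ := fun (f : Set.Iic u → ℝ) (q : ℚ≥0) => √2 * f ⟨min (q : ℝ≥0) u, Set.mem_Iic.2 (min_le_right _ _)⟩ + c)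
      (ψ := fun f : ℝ≥0 → ℝ => √2 * f (t - u)) (by fun_prop) (by fun_prop)
    convert h using 1
    · funext ω q
      simp only [Function.comp]
      field_simp
      ring
    · funext ω
      simp only [Function.comp, add_tsub_cancel_of_le hut]
      field_simp
      ring
  have h5 := ProbabilityTheory.IndepFun.prodMk_prodMk_comm
    (aemeasurable_pi_lambda _ fun q => hr _) (aemeasurable_pi_lambda _ fun q => hi _)
    ((hr t).sub (hr u)) ((hi t).sub (hi u)) h (hs _ _ hW.re) (hs _ _ hW.im)
    (h.comp measurable_fst measurable_fst) (h.comp measurable_snd measurable_snd)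
  have h6 := h5.comp
    (φ := fun (p : (ℚ≥0 → ℝ) × (ℚ≥0 → ℝ)) (q : ℚ≥0) => (p.1 q : ℂ) + p.2 q * Complex.I)
    (ψ := fun p : ℝ × ℝ => (p.1 : ℂ) + p.2 * Complex.I) (by fun_prop) (by fun_prop)
  convert h6 using 1
  · funext ω q
    simp [pathSample, Complex.re_add_im]
  · funext ω
    apply Complex.ext <;> simp

end IsPlanarBrownian

/-! ### The law of an increment -/

/-- The density of a centred planar Gaussian whose coordinates have variance `v`. -/
noncomputable def planarGaussianPDF (v : ℝ≥0) (z : ℂ) : ℝ :=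
  gaussianPDFReal 0 v z.re * gaussianPDFReal 0 v z.im

theorem planarGaussianPDF_nonneg (v : ℝ≥0) (z : ℂ) : 0 ≤ planarGaussianPDF v z :=
  mul_nonneg (gaussianPDFReal_nonneg _ _ _) (gaussianPDFReal_nonneg _ _ _)

theorem continuous_planarGaussianPDF (v : ℝ≥0) : Continuous (planarGaussianPDF v) := by
  unfold planarGaussianPDF gaussianPDFReal
  fun_prop

theorem planarGaussianPDF_le (v : ℝ≥0) (z : ℂ) :
    planarGaussianPDF v z ≤ (2 * Real.pi * v)⁻¹ := by
  have h : ∀ y : ℝ, gaussianPDFReal 0 v y ≤ (√(2 * Real.pi * v))⁻¹ := by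
    intro y
    rw [gaussianPDFReal]
    refine mul_le_of_le_one_right (by positivity) (Real.exp_le_one_iff.2 ?_)
    rw [neg_div]
    exact neg_nonpos.2 (by positivity)
  calc planarGaussianPDF v z ≤ (√(2 * Real.pi * v))⁻¹ * (√(2 * Real.pi * v))⁻¹ :=
        mul_le_mul (h _) (h _) (gaussianPDFReal_nonneg _ _ _) (by positivity)
    _ = (2 * Real.pi * v)⁻¹ := by
        rw [← mul_inv, Real.mul_self_sqrt (by positivity)]

theorem IsPlanarBrownian.map_sub (hW : IsPlanarBrownian W x P) {u t : ℝ≥0} (hut : u < t) :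
    P.map (fun ω => W t ω - W u ω) =
      volume.withDensity fun z => ENNReal.ofReal (planarGaussianPDF (2 * (t - u)) z) := by
  have := hW.isProbabilityMeasure
  have hv : 2 * (t - u) ≠ 0 := by
    have := tsub_pos_of_lt hut
    positivity
  have hs : ∀ (Z : ℝ≥0 → X → ℝ) (c : ℝ), IsBrownianReal (fun s ω => (Z s ω - c) / √2) P →
      P.map (fun ω => Z t ω - Z u ω) = gaussianReal 0 (2 * (t - u)) := by
    intro Z c hZ
    have h := gaussianReal_const_mul (hZ.hasLaw_sub t u) √2
    have e1 : (fun ω => Z t ω - Z u ω) = fun ω => √2 *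
        (((fun s ω => (Z s ω - c) / √2) t - (fun s ω => (Z s ω - c) / √2) u) ω) := by
      funext ω
      simp only [Pi.sub_apply]
      field_simp
      ring
    rw [e1, h.map_eq, mul_zero]
    congr 1
    ext
    have hd : dist (t : ℝ) (u : ℝ) = t - u := by
      rw [Real.dist_eq, abs_of_nonneg (sub_nonneg.2 (by exact_mod_cast hut.le))]
    push_cast [NNReal.coe_sub hut.le]
    rw [Real.sq_sqrt zero_le_two]
    exact congrArg (2 * ·) hd
  have hre := hs _ _ hW.re
  have him := hs _ _ hW.im
  have hind : IndepFun (fun ω => (W t ω).re - (W u ω).re) (fun ω => (W t ω).im - (W u ω).im) P :=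
    hW.indep.comp (φ := fun f : ℝ≥0 → ℝ => f t - f u) (ψ := fun f : ℝ≥0 → ℝ => f t - f u)
      (by fun_prop) (by fun_prop)
  have mr : AEMeasurable (fun ω => (W t ω).re - (W u ω).re) P :=
    (hW.aemeasurable_re t).sub (hW.aemeasurable_re u)
  have mi : AEMeasurable (fun ω => (W t ω).im - (W u ω).im) P :=
    (hW.aemeasurable_im t).sub (hW.aemeasurable_im u)
  have hprod := (indepFun_iff_map_prod_eq_prod_map_map mr mi).1 hind
  rw [hre, him, gaussianReal_of_var_ne_zero _ hv, prod_withDensity (by fun_prop) (by fun_prop)]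
    at hprod
  have e : (fun ω => W t ω - W u ω) = Complex.measurableEquivRealProd.symm ∘
      fun ω => ((W t ω).re - (W u ω).re, (W t ω).im - (W u ω).im) := by
    funext ω
    apply Complex.ext <;> simp [Complex.measurableEquivRealProd]
  rw [e, ← AEMeasurable.map_map_of_aemeasurable
    (Complex.measurableEquivRealProd.symm.measurable.aemeasurable) (mr.prodMk mi), hprod]
  ext A hA
  have hA' := Complex.measurableEquivRealProd.symm.measurable hA
  rw [Measure.map_apply Complex.measurableEquivRealProd.symm.measurable hA,
    withDensity_apply _ hA', withDensity_apply _ hA,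
    ← Complex.volume_preserving_equiv_real_prod.symm.setLIntegral_comp_preimage_emb
      Complex.measurableEquivRealProd.symm.measurableEmbedding]
  refine lintegral_congr fun p => ?_
  simp only [planarGaussianPDF, gaussianPDF]
  rw [← ENNReal.ofReal_mul (gaussianPDFReal_nonneg _ _ _)]
  simp [Complex.measurableEquivRealProd]

end

/-! ### The maximal inequality -/

theorem lintegral_exp_mul_gaussianReal (v : ℝ≥0) (l : ℝ) :
    ∫⁻ y, ENNReal.ofReal (Real.exp (l * y)) ∂(gaussianReal 0 v) =
      ENNReal.ofReal (Real.exp (v * l ^ 2 / 2)) := by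
  rw [← ofReal_integral_eq_lintegral_ofReal (integrable_exp_mul_gaussianReal l)
    (Eventually.of_forall fun _ => (Real.exp_pos _).le)]
  have h := congrFun (mgf_id_gaussianReal (μ := 0) (v := v)) l
  simp only [mgf, id] at h
  rw [h]
  simp

/-- Doob's argument for the submartingale `exp (l * B s)`: split according to the first time in `I`
at which `B` reaches `a`, and compare with time `u` using the independent increment, whose
exponential has mean at least `1`. -/
theorem ProbabilityTheory.IsPreBrownianReal.measure_exists_finset_le {X : Type*}
    [MeasurableSpace X] {P : Measure X} {B : ℝ≥0 → X → ℝ} (hB : IsPreBrownianReal B P) {a : ℝ}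
    (ha : 0 < a) {u : ℝ≥0} (hu : 0 < u) (I : Finset ℝ≥0) (hI : ∀ s ∈ I, s ≤ u) :
    P {ω | ∃ s ∈ I, a ≤ B s ω} ≤ ENNReal.ofReal (Real.exp (-(a ^ 2 / (2 * u)))) := by
  -- Only finitely many times occur, so a measurable modification changes the event by a null set.
  wlog hm : ∀ s, Measurable (B s) generalizing B
  · have hae : ∀ s, B s =ᵐ[P] (hB.aemeasurable s).mk (B s) := fun s => (hB.aemeasurable s).ae_eq_mk
    refine le_trans ?_ (this (hB.congr hae) fun s => (hB.aemeasurable s).measurable_mk)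
    refine measure_mono_ae ?_
    have h : ∀ᵐ ω ∂P, ∀ s : I, B s ω = (hB.aemeasurable s).mk (B s) ω := ae_all_iff.2 fun s => hae s
    filter_upwards [h] with ω hω
    rintro ⟨s, hs, hle⟩
    exact ⟨s, hs, hω ⟨s, hs⟩ ▸ hle⟩
  have hprob : IsProbabilityMeasure P := hB.isGaussianProcess.isProbabilityMeasure
  have hu' : (0 : ℝ) < u := hu
  -- This value minimizes the Chernoff exponent `u * l² / 2 - l * a`.
  set l : ℝ := a / u with hl
  let f : ℝ≥0 → X → ℝ≥0∞ := fun s ω => ENNReal.ofReal (Real.exp (l * B s ω))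
  have hf : ∀ s, Measurable (f s) := fun s => by have := hm s; simp only [f]; fun_prop
  let A : ℝ≥0 → Set X := fun s => {ω | a ≤ B s ω ∧ ∀ r ∈ I, r < s → B r ω < a}
  have hA : ∀ s, MeasurableSet (A s) := by
    intro s
    refine (measurableSet_le measurable_const (hm s)).inter ?_
    have : {ω | ∀ r ∈ I, r < s → B r ω < a} = ⋂ r ∈ I, ⋂ (_ : r < s), {ω | B r ω < a} := by
      ext; simp
    change MeasurableSet {ω | ∀ r ∈ I, r < s → B r ω < a}
    rw [this]
    exact Finset.measurableSet_biInter _ fun r _ => MeasurableSet.iInter fun _ =>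
      measurableSet_lt (hm r) measurable_const
  have hcover : {ω | ∃ s ∈ I, a ≤ B s ω} ⊆ ⋃ s ∈ I, A s := by
    rintro ω ⟨s, hs, hle⟩
    have hne : (I.filter fun s => a ≤ B s ω).Nonempty := ⟨s, Finset.mem_filter.2 ⟨hs, hle⟩⟩
    obtain ⟨m, hm, hmin⟩ := Finset.exists_min_image _ (fun s => s) hne
    obtain ⟨h1, h2⟩ := Finset.mem_filter.1 hm
    refine Set.mem_biUnion h1 ⟨h2, fun r hr hlt => ?_⟩
    by_contra hn
    have h3 : m ≤ r := hmin r (Finset.mem_filter.2 ⟨hr, not_lt.1 hn⟩)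
    exact absurd h3 (not_le.2 hlt)
  have hdisj : Set.PairwiseDisjoint (I : Set ℝ≥0) A := by
    intro s hs r hr hsr
    rw [Function.onFun, Set.disjoint_left]
    rintro ω ⟨h1, h2⟩ ⟨h3, h4⟩
    rcases lt_or_gt_of_ne hsr with h | h
    · exact absurd (h4 s hs h) (not_lt.2 h1)
    · exact absurd (h2 r hr h) (not_lt.2 h3)
  have hone : ∀ s ≤ u, ENNReal.ofReal (Real.exp (l * a)) * P (A s) ≤ ∫⁻ ω in A s, f u ω ∂P := by
    intro s hs
    let φ : (Set.Iic s → ℝ) → ℝ≥0∞ := Set.indicator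
      {p | a ≤ p ⟨s, Set.mem_Iic.2 le_rfl⟩ ∧
        ∀ r, ∀ (_ : r ∈ I) (h : r < s), p ⟨r, Set.mem_Iic.2 h.le⟩ < a}
      (fun p => ENNReal.ofReal (Real.exp (l * p ⟨s, Set.mem_Iic.2 le_rfl⟩)))
    have hφ : Measurable φ := by
      refine Measurable.indicator (by fun_prop) ?_
      refine (measurableSet_le measurable_const (measurable_pi_apply _)).inter ?_
      have e : {p : Set.Iic s → ℝ | ∀ r, ∀ (_ : r ∈ I) (h : r < s), p ⟨r, Set.mem_Iic.2 h.le⟩ < a} =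
          ⋂ r ∈ I, ⋂ (h : r < s), {p | p ⟨r, Set.mem_Iic.2 h.le⟩ < a} := by
        ext; simp
      change MeasurableSet {p : Set.Iic s → ℝ | ∀ r, ∀ (_ : r ∈ I) (h : r < s),
        p ⟨r, Set.mem_Iic.2 h.le⟩ < a}
      rw [e]
      exact Finset.measurableSet_biInter _ fun r _ => MeasurableSet.iInter fun _ =>
        measurableSet_lt (measurable_pi_apply _) measurable_const
    let g : X → ℝ≥0∞ := fun ω => ENNReal.ofReal (Real.exp (l * (B u ω - B s ω)))
    have hg : Measurable g := by have := hm u; have := hm s; simp only [g]; fun_prop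
    have hind : IndepFun ((A s).indicator (f s)) g P := by
      have h := ((hB.indepFun_shift s).symm).comp (φ := φ)
        (ψ := fun q : ℝ≥0 → ℝ => ENNReal.ofReal (Real.exp (l * q (u - s)))) hφ (by fun_prop)
      convert h using 1
      · rfl
      · funext ω
        simp only [Function.comp, add_tsub_cancel_of_le hs, g]
    have hg1 : 1 ≤ ∫⁻ ω, g ω ∂P := by
      have h := (hB.hasLaw_sub u s).lintegral_comp
        (f := fun y => ENNReal.ofReal (Real.exp (l * y))) (by fun_prop)
      rw [lintegral_exp_mul_gaussianReal] at h
      have e : ∫⁻ ω, g ω ∂P = _ := h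
      rw [e]
      exact ENNReal.one_le_ofReal.2 (Real.one_le_exp (by positivity))
    calc ENNReal.ofReal (Real.exp (l * a)) * P (A s)
        = ∫⁻ _ in A s, ENNReal.ofReal (Real.exp (l * a)) ∂P := (setLIntegral_const _ _).symm
      _ ≤ ∫⁻ ω in A s, f s ω ∂P := by
          refine setLIntegral_mono (hf s) fun ω hω => ?_
          refine ENNReal.ofReal_le_ofReal (Real.exp_le_exp.2 ?_)
          exact mul_le_mul_of_nonneg_left hω.1 (by positivity)
      _ = ∫⁻ ω, (A s).indicator (f s) ω ∂P := (lintegral_indicator (hA s) _).symm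
      _ ≤ (∫⁻ ω, (A s).indicator (f s) ω ∂P) * ∫⁻ ω, g ω ∂P := le_mul_of_one_le_right' hg1
      _ = ∫⁻ ω, (A s).indicator (f s) ω * g ω ∂P :=
          (lintegral_mul_eq_lintegral_mul_lintegral_of_indepFun
            ((hf s).indicator (hA s)) hg hind).symm
      _ = ∫⁻ ω in A s, f u ω ∂P := by
          rw [← lintegral_indicator (hA s)]
          refine lintegral_congr fun ω => ?_
          by_cases h : ω ∈ A s
          · simp only [Set.indicator_of_mem h, f, g]
            rw [← ENNReal.ofReal_mul (Real.exp_pos _).le, ← Real.exp_add]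
            congr 2
            ring
          · simp [Set.indicator_of_notMem h]
  have hsum : ENNReal.ofReal (Real.exp (l * a)) * P {ω | ∃ s ∈ I, a ≤ B s ω} ≤
      ENNReal.ofReal (Real.exp (u * l ^ 2 / 2)) := by
    calc ENNReal.ofReal (Real.exp (l * a)) * P {ω | ∃ s ∈ I, a ≤ B s ω}
        ≤ ENNReal.ofReal (Real.exp (l * a)) * ∑ s ∈ I, P (A s) := by
          gcongr
          exact (measure_mono hcover).trans (measure_biUnion_finset_le I A)
      _ = ∑ s ∈ I, ENNReal.ofReal (Real.exp (l * a)) * P (A s) := Finset.mul_sum _ _ _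
      _ ≤ ∑ s ∈ I, ∫⁻ ω in A s, f u ω ∂P := Finset.sum_le_sum fun s hs => hone s (hI s hs)
      _ = ∫⁻ ω in ⋃ s ∈ I, A s, f u ω ∂P :=
          (lintegral_biUnion_finset hdisj (fun s _ => hA s) _).symm
      _ ≤ ∫⁻ ω, f u ω ∂P := setLIntegral_le_lintegral _ _
      _ = ENNReal.ofReal (Real.exp (u * l ^ 2 / 2)) := by
          rw [← lintegral_exp_mul_gaussianReal]
          exact (hB.hasLaw_eval u).lintegral_comp
            (f := fun y => ENNReal.ofReal (Real.exp (l * y))) (by fun_prop)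
  rw [mul_comm] at hsum
  have h2 := (ENNReal.le_div_iff_mul_le (Or.inl (by simp [Real.exp_pos]))
    (Or.inl ENNReal.ofReal_ne_top)).2 hsum
  rw [← ENNReal.ofReal_div_of_pos (Real.exp_pos _), ← Real.exp_sub] at h2
  refine h2.trans (le_of_eq ?_)
  congr 2
  rw [hl]
  field_simp
  ring

theorem ProbabilityTheory.IsPreBrownianReal.measure_exists_le {X : Type*} [MeasurableSpace X]
    {P : Measure X} {B : ℝ≥0 → X → ℝ} (hB : IsPreBrownianReal B P) {a : ℝ} (ha : 0 < a) {u : ℝ≥0}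
    (hu : 0 < u) :
    P {ω | ∃ q : ℚ≥0, a ≤ B (min (q : ℝ≥0) u) ω} ≤
      ENNReal.ofReal (Real.exp (-(a ^ 2 / (2 * u)))) := by
  have e : {ω | ∃ q : ℚ≥0, a ≤ B (min (q : ℝ≥0) u) ω} =
      ⋃ J : Finset ℚ≥0, {ω | ∃ s ∈ J.image fun q : ℚ≥0 => min (q : ℝ≥0) u, a ≤ B s ω} := by
    ext ω
    simp only [Set.mem_ofPred_eq, Set.mem_iUnion]
    constructor
    · rintro ⟨q, hq⟩
      exact ⟨{q}, _, by simp, hq⟩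
    · rintro ⟨J, s, hs, hle⟩
      obtain ⟨q, -, rfl⟩ := Finset.mem_image.1 hs
      exact ⟨q, hle⟩
  rw [e, Directed.measure_iUnion]
  · refine iSup_le fun J => hB.measure_exists_finset_le ha hu _ fun s hs => ?_
    obtain ⟨q, -, rfl⟩ := Finset.mem_image.1 hs
    exact min_le_right _ _
  · refine Monotone.directed_le fun J K hJK ω => ?_
    rintro ⟨s, hs, hle⟩
    exact ⟨s, Finset.image_subset_image hJK hs, hle⟩

/-! ### Planar displacement bounds and averages over shrinking disks. -/

section
variable {X : Type*} [MeasurableSpace X] {P : Measure X} {W : ℝ≥0 → X → ℂ} {x : ℂ}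

namespace IsPlanarBrownian

theorem measure_exists_lt_norm_le (hW : IsPlanarBrownian W x P) {b : ℝ} (hb : 0 < b) {u : ℝ≥0}
    (hu : 0 < u) :
    P {ω | ∃ q, b < ‖pathSample u (fun s => W s ω) q - x‖} ≤
      ENNReal.ofReal (4 * Real.exp (-(b ^ 2 / (8 * u)))) := by
  -- A displacement exceeding `b` forces one of the two normalized coordinates beyond `b / 2` in
  -- absolute value, because of the factor `√2`. Two coordinates and two signs give the constant
  -- `4`.
  have hb2 : 0 < b / 2 := by positivity
  have e : Real.exp (-((b / 2) ^ 2 / (2 * u))) = Real.exp (-(b ^ 2 / (8 * u))) := by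
    congr 2
    have : (0 : ℝ) < u := hu
    field_simp
    ring
  have h1 := hW.re.toIsPreBrownianReal.measure_exists_le hb2 hu
  have h2 := hW.re.toIsPreBrownianReal.neg.measure_exists_le hb2 hu
  have h3 := hW.im.toIsPreBrownianReal.measure_exists_le hb2 hu
  have h4 := hW.im.toIsPreBrownianReal.neg.measure_exists_le hb2 hu
  rw [e] at h1 h2 h3 h4
  have hsub : {ω | ∃ q, b < ‖pathSample u (fun s => W s ω) q - x‖} ⊆
      (({ω | ∃ q : ℚ≥0, b / 2 ≤ (fun s ω => ((W s ω).re - x.re) / √2) (min (q : ℝ≥0) u) ω} ∪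
      {ω | ∃ q : ℚ≥0, b / 2 ≤ (-(fun s ω => ((W s ω).re - x.re) / √2)) (min (q : ℝ≥0) u) ω}) ∪
      {ω | ∃ q : ℚ≥0, b / 2 ≤ (fun s ω => ((W s ω).im - x.im) / √2) (min (q : ℝ≥0) u) ω}) ∪
      {ω | ∃ q : ℚ≥0, b / 2 ≤ (-(fun s ω => ((W s ω).im - x.im) / √2)) (min (q : ℝ≥0) u) ω} := by
    rintro ω ⟨q, hq⟩
    by_contra hn
    simp only [Set.mem_union, Set.mem_ofPred_eq, not_or, not_exists, not_le, Pi.neg_apply] at hn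
    obtain ⟨⟨⟨n1, n2⟩, n3⟩, n4⟩ := hn
    have k1 : (((W (min (q : ℝ≥0) u) ω).re - x.re) / √2) ^ 2 < (b / 2) ^ 2 :=
      sq_lt_sq' (by linarith [n2 q]) (n1 q)
    have k2 : (((W (min (q : ℝ≥0) u) ω).im - x.im) / √2) ^ 2 < (b / 2) ^ 2 :=
      sq_lt_sq' (by linarith [n4 q]) (n3 q)
    rw [div_pow, Real.sq_sqrt zero_le_two] at k1 k2
    have k3 : ‖pathSample u (fun s => W s ω) q - x‖ ^ 2 =
        ((W (min (q : ℝ≥0) u) ω).re - x.re) ^ 2 + ((W (min (q : ℝ≥0) u) ω).im - x.im) ^ 2 := by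
      rw [Complex.sq_norm, Complex.normSq_apply, pathSample]
      simp only [Complex.sub_re, Complex.sub_im]
      ring
    have k4 : b ^ 2 < ‖pathSample u (fun s => W s ω) q - x‖ ^ 2 := pow_lt_pow_left₀ hq hb.le two_ne_zero
    linarith
  refine (measure_mono hsub).trans ?_
  refine (measure_union_le _ _).trans ?_
  refine (add_le_add ((measure_union_le _ _).trans (add_le_add (measure_union_le _ _) le_rfl))
    le_rfl).trans ?_
  refine (add_le_add (add_le_add (add_le_add h1 h2) h3) h4).trans (le_of_eq ?_)
  rw [← ENNReal.ofReal_add (by positivity) (by positivity), ← ENNReal.ofReal_add (by positivity)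
    (by positivity), ← ENNReal.ofReal_add (by positivity) (by positivity)]
  congr 1
  ring

theorem map_sub_closedBall_le (hW : IsPlanarBrownian W x P) {u t : ℝ≥0} (hut : u < t) (z : ℂ)
    {r : ℝ} (hr : 0 ≤ r) :
    P.map (fun ω => W t ω - W u ω) (Metric.closedBall z r) ≤
      ENNReal.ofReal (r ^ 2 / (4 * (t - u))) := by
  have hd : (0 : ℝ) < t - u := sub_pos.2 (by exact_mod_cast hut)
  rw [hW.map_sub hut, withDensity_apply _ Metric.isClosed_closedBall.measurableSet]
  calc ∫⁻ w in Metric.closedBall z r, ENNReal.ofReal (planarGaussianPDF (2 * (t - u)) w)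
      ≤ ∫⁻ _ in Metric.closedBall z r, ENNReal.ofReal (4 * Real.pi * (t - u))⁻¹ := by
        refine lintegral_mono fun w => ENNReal.ofReal_le_ofReal ?_
        refine (planarGaussianPDF_le _ _).trans (le_of_eq ?_)
        push_cast [NNReal.coe_sub hut.le]
        ring
    _ = ENNReal.ofReal (r ^ 2 / (4 * (t - u))) := by
        rw [setLIntegral_const, Complex.volume_closedBall, ← ENNReal.ofReal_pow hr,
          ← ENNReal.ofReal_coe_nnreal, ← ENNReal.ofReal_mul (by positivity),
          ← ENNReal.ofReal_mul (by positivity)]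
        congr 1
        simp only [NNReal.coe_real_pi]
        field_simp

/-- Given the past up to `u`, landing near `x` means that an independent increment falls in a disk
of radius `r`, wherever that disk is centred. -/
theorem measure_norm_sub_le_inter (hW : IsPlanarBrownian W x P) {u t : ℝ≥0} (hut : u < t)
    {M : Set (ℚ≥0 → ℂ)} (hM : MeasurableSet M) {r : ℝ} (hr : 0 ≤ r) :
    P {ω | ‖W t ω - x‖ ≤ r ∧ pathSample u (fun s => W s ω) ∈ M} ≤
      ENNReal.ofReal (r ^ 2 / (4 * (t - u))) * P {ω | pathSample u (fun s => W s ω) ∈ M} := by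
  have := hW.isProbabilityMeasure
  have hs := hW.aemeasurable_pathSample u
  have hn : AEMeasurable (fun ω => W t ω - W u ω) P := (hW.aemeasurable t).sub (hW.aemeasurable u)
  let E : Set ((ℚ≥0 → ℂ) × ℂ) := {p | ‖p.1 (⌈u⌉₊ : ℚ≥0) + p.2 - x‖ ≤ r ∧ p.1 ∈ M}
  have hE : MeasurableSet E :=
    (measurableSet_le (f := fun p : (ℚ≥0 → ℂ) × ℂ => ‖p.1 (⌈u⌉₊ : ℚ≥0) + p.2 - x‖) (by fun_prop)
      measurable_const).inter (measurable_fst hM)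
  have e : {ω | ‖W t ω - x‖ ≤ r ∧ pathSample u (fun s => W s ω) ∈ M} =
      (fun ω => (pathSample u (fun s => W s ω), W t ω - W u ω)) ⁻¹' E := by
    ext ω
    simp [E, pathSample_ceil]
  have e2 : {ω | pathSample u (fun s => W s ω) ∈ M} = (fun ω => pathSample u (fun s => W s ω)) ⁻¹' M :=
    rfl
  rw [e, e2, ← Measure.map_apply_of_aemeasurable (hs.prodMk hn) hE,
    (indepFun_iff_map_prod_eq_prod_map_map hs hn).1 (hW.indepFun_pathSample hut.le),
    ← Measure.map_apply_of_aemeasurable hs hM, Measure.prod_apply hE]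
  calc ∫⁻ p, P.map (fun ω => W t ω - W u ω) (Prod.mk p ⁻¹' E)
        ∂(P.map fun ω => pathSample u fun s => W s ω)
      ≤ ∫⁻ p, M.indicator (fun _ => ENNReal.ofReal (r ^ 2 / (4 * (t - u)))) p
        ∂(P.map fun ω => pathSample u fun s => W s ω) := by
        refine lintegral_mono fun p => ?_
        by_cases hp : p ∈ M
        · rw [Set.indicator_of_mem hp]
          refine le_trans (measure_mono ?_)
            (hW.map_sub_closedBall_le hut (x - p (⌈u⌉₊ : ℚ≥0)) hr)
          rintro n ⟨hn1, -⟩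
          rw [mem_closedBall_iff_norm]
          refine le_trans (le_of_eq ?_) hn1
          congr 1
          ring
        · rw [Set.indicator_of_notMem hp]
          have : Prod.mk p ⁻¹' E = ∅ := Set.eq_empty_of_forall_notMem fun n hn => hp hn.2
          rw [this, measure_empty]
    _ = _ := by
        rw [lintegral_indicator hM, setLIntegral_const]

theorem tendsto_map_sub_closedBall (hW : IsPlanarBrownian W x P) {u t : ℝ≥0} (hut : u < t)
    (z : ℂ) :
    Tendsto (fun r : ℝ => 1 / (Real.pi * r ^ 2) *
      (P.map (fun ω => W t ω - W u ω)).real (Metric.closedBall z r)) (𝓝[>] 0)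
      (𝓝 (planarGaussianPDF (2 * (t - u)) z)) := by
  set p := planarGaussianPDF (2 * (t - u))
  have hp : Continuous p := continuous_planarGaussianPDF _
  rw [Metric.tendsto_nhds]
  intro ε hε
  obtain ⟨δ, hδ, hδ'⟩ := Metric.continuousAt_iff.1 (hp.continuousAt (x := z)) (ε / 2) (half_pos hε)
  filter_upwards [Ioo_mem_nhdsGT hδ] with r hr
  have hr0 : 0 < r := hr.1
  have hvol : volume.real (Metric.closedBall z r) = Real.pi * r ^ 2 := by
    rw [measureReal_def, Complex.volume_closedBall, ENNReal.toReal_mul, ENNReal.toReal_pow,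
      ENNReal.toReal_ofReal hr0.le]
    simp [mul_comm]
  have hfin : volume (Metric.closedBall z r) ≠ ⊤ := by
    rw [Complex.volume_closedBall]
    exact ENNReal.mul_ne_top (by simp) (by simp)
  have hint : IntegrableOn p (Metric.closedBall z r) :=
    hp.continuousOn.integrableOn_compact (isCompact_closedBall z r)
  have h1 : (P.map (fun ω => W t ω - W u ω)).real (Metric.closedBall z r) =
      ∫ w in Metric.closedBall z r, p w := by
    rw [measureReal_def, hW.map_sub hut,
      withDensity_apply _ Metric.isClosed_closedBall.measurableSet,
      integral_eq_lintegral_of_nonneg_ae (Eventually.of_forall (planarGaussianPDF_nonneg _))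
        hp.aestronglyMeasurable]
  have h2 : ∫ w in Metric.closedBall z r, (p w - p z) =
      (∫ w in Metric.closedBall z r, p w) - Real.pi * r ^ 2 * p z := by
    rw [integral_sub hint (integrableOn_const hfin), setIntegral_const, hvol, smul_eq_mul]
  have h3 : ‖∫ w in Metric.closedBall z r, (p w - p z)‖ ≤ ε / 2 * (Real.pi * r ^ 2) := by
    rw [← hvol]
    refine norm_setIntegral_le_of_norm_le_const hfin.lt_top fun w hw => ?_
    have := hδ' (lt_of_le_of_lt (Metric.mem_closedBall.1 hw) hr.2)
    exact this.le
  have hpos : 0 < Real.pi * r ^ 2 := by positivity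
  rw [h1, dist_eq_norm]
  have e : 1 / (Real.pi * r ^ 2) * (∫ w in Metric.closedBall z r, p w) - p z =
      1 / (Real.pi * r ^ 2) * ∫ w in Metric.closedBall z r, (p w - p z) := by
    rw [h2]
    field_simp
  rw [e, norm_mul, Real.norm_of_nonneg (by positivity)]
  calc 1 / (Real.pi * r ^ 2) * ‖∫ w in Metric.closedBall z r, (p w - p z)‖
      ≤ 1 / (Real.pi * r ^ 2) * (ε / 2 * (Real.pi * r ^ 2)) := by gcongr
    _ = ε / 2 := by field_simp
    _ < ε := half_lt_self hε

/-- Integrating out the increment replaces the indicator by the mass of a small disk; divided by its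
area, this converges to the Gaussian density and is bounded by the maximum of that density, so
dominated convergence applies. -/
theorem tendsto_average_pathSample (hW : IsPlanarBrownian W x P) {u t : ℝ≥0} (hut : u < t)
    {H : (ℚ≥0 → ℂ) → ℂ} (hH : Measurable H) (hH1 : ∀ p, ‖H p‖ ≤ 1) :
    ∃ l : ℂ, Tendsto (fun r : ℝ => ((1 / (Real.pi * r ^ 2) : ℝ) : ℂ) *
      ∫ ω, (if ‖W t ω - x‖ ≤ r then H (pathSample u fun s => W s ω) else 0) ∂P)
      (𝓝[>] 0) (𝓝 l) := by
  have := hW.isProbabilityMeasure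
  have hs := hW.aemeasurable_pathSample u
  have hn : AEMeasurable (fun ω => W t ω - W u ω) P := (hW.aemeasurable t).sub (hW.aemeasurable u)
  set μ := P.map fun ω => pathSample u fun s => W s ω
  set ν := P.map fun ω => W t ω - W u ω
  have : IsProbabilityMeasure μ := Measure.isProbabilityMeasure_map hs
  have : IsProbabilityMeasure ν := Measure.isProbabilityMeasure_map hn
  have hd : (0 : ℝ) < t - u := sub_pos.2 (by exact_mod_cast hut)
  have key : ∀ r : ℝ, ∫ ω, (if ‖W t ω - x‖ ≤ r then H (pathSample u fun s => W s ω) else 0) ∂P =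
      ∫ p, H p * (ν.real (Metric.closedBall (x - p (⌈u⌉₊ : ℚ≥0)) r) : ℂ) ∂μ := by
    intro r
    let g : (ℚ≥0 → ℂ) × ℂ → ℂ := fun p => if ‖p.1 (⌈u⌉₊ : ℚ≥0) + p.2 - x‖ ≤ r then H p.1 else 0
    have hg : Measurable g := Measurable.ite
      (measurableSet_le (f := fun p : (ℚ≥0 → ℂ) × ℂ => ‖p.1 (⌈u⌉₊ : ℚ≥0) + p.2 - x‖) (by fun_prop)
        measurable_const) (by fun_prop) measurable_const
    have e1 : ∫ ω, (if ‖W t ω - x‖ ≤ r then H (pathSample u fun s => W s ω) else 0) ∂P =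
        ∫ ω, g (pathSample u (fun s => W s ω), W t ω - W u ω) ∂P := by
      simp [g, pathSample_ceil]
    rw [e1, ← integral_map (hs.prodMk hn) hg.aestronglyMeasurable,
      (indepFun_iff_map_prod_eq_prod_map_map hs hn).1 (hW.indepFun_pathSample hut.le),
      integral_prod]
    · refine integral_congr_ae (Eventually.of_forall fun p => ?_)
      have e2 : ∀ n, g (p, n) =
          (Metric.closedBall (x - p (⌈u⌉₊ : ℚ≥0)) r).indicator (fun _ => H p) n := by
        intro n
        have e3 : n ∈ Metric.closedBall (x - p (⌈u⌉₊ : ℚ≥0)) r ↔ ‖p (⌈u⌉₊ : ℚ≥0) + n - x‖ ≤ r := by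
          rw [mem_closedBall_iff_norm, show n - (x - p (⌈u⌉₊ : ℚ≥0)) = p (⌈u⌉₊ : ℚ≥0) + n - x by ring]
        by_cases hmem : n ∈ Metric.closedBall (x - p (⌈u⌉₊ : ℚ≥0)) r
        · rw [Set.indicator_of_mem hmem]
          exact if_pos (e3.1 hmem)
        · rw [Set.indicator_of_notMem hmem]
          exact if_neg (mt e3.2 hmem)
      simp only [e2]
      rw [integral_indicator Metric.isClosed_closedBall.measurableSet, setIntegral_const,
        Complex.real_smul, mul_comm]
    · refine Integrable.of_bound hg.aestronglyMeasurable 1 (Eventually.of_forall fun p => ?_)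
      simp only [g]
      split_ifs
      · exact hH1 _
      · simp
  refine ⟨∫ p, H p * (planarGaussianPDF (2 * (t - u)) (x - p (⌈u⌉₊ : ℚ≥0)) : ℂ) ∂μ, ?_⟩
  simp only [key, ← integral_const_mul]
  refine tendsto_integral_filter_of_dominated_convergence (fun _ => 1 / (4 * Real.pi * (t - u)))
    (Eventually.of_forall fun r => ?_) ?_ (integrable_const _) (Eventually.of_forall fun p => ?_)
  · have hm : Measurable fun p : ℚ≥0 → ℂ => ν (Metric.closedBall (x - p (⌈u⌉₊ : ℚ≥0)) r) := by
      have hset : MeasurableSet {q : (ℚ≥0 → ℂ) × ℂ | ‖q.2 - (x - q.1 (⌈u⌉₊ : ℚ≥0))‖ ≤ r} :=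
        measurableSet_le (by fun_prop) measurable_const
      have h := measurable_measure_prodMk_left (ν := ν) hset
      convert h using 3
      ext n
      rw [mem_closedBall_iff_norm]
      rfl
    have hm' : Measurable fun p : ℚ≥0 → ℂ => ν.real (Metric.closedBall (x - p (⌈u⌉₊ : ℚ≥0)) r) :=
      hm.ennreal_toReal
    exact Measurable.aestronglyMeasurable (by fun_prop)
  · filter_upwards [self_mem_nhdsWithin] with r hr
    have hr0 : (0 : ℝ) < r := hr
    refine Eventually.of_forall fun p => ?_
    have h1 : ν.real (Metric.closedBall (x - p (⌈u⌉₊ : ℚ≥0)) r) ≤ r ^ 2 / (4 * (t - u)) :=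
      ENNReal.toReal_le_of_le_ofReal (by positivity)
        (hW.map_sub_closedBall_le hut (x - p (⌈u⌉₊ : ℚ≥0)) hr0.le)
    rw [norm_mul, norm_mul, Complex.norm_real, Complex.norm_real,
      Real.norm_of_nonneg (by positivity), Real.norm_of_nonneg measureReal_nonneg]
    calc 1 / (Real.pi * r ^ 2) * (‖H p‖ * ν.real (Metric.closedBall (x - p (⌈u⌉₊ : ℚ≥0)) r))
        ≤ 1 / (Real.pi * r ^ 2) * (1 * (r ^ 2 / (4 * (t - u)))) := by
          gcongr
          exact hH1 p
      _ = 1 / (4 * Real.pi * (t - u)) := by field_simp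
  · have h := hW.tendsto_map_sub_closedBall hut (x - p (⌈u⌉₊ : ℚ≥0))
    have h2 := ((Complex.continuous_ofReal.tendsto _).comp h).const_mul (H p)
    refine h2.congr fun r => ?_
    simp only [Function.comp]
    push_cast
    ring

end IsPlanarBrownian
end

/-! ### Approximation tools and factorization of the phase. -/

theorem exists_tendsto_of_approx {α E : Type*} [NormedAddCommGroup E] [CompleteSpace E]
    {F : Filter α} [F.NeBot] {f : α → E}
    (h : ∀ ε > 0, ∃ g : α → E, ∃ l, Tendsto g F (𝓝 l) ∧ ∀ᶠ r in F, ‖f r - g r‖ ≤ ε) :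
    ∃ l, Tendsto f F (𝓝 l) := by
  rw [← cauchy_map_iff_exists_tendsto, Metric.cauchy_iff]
  refine ⟨inferInstance, fun ε hε => ?_⟩
  obtain ⟨g, l, hg, hfg⟩ := h (ε / 4) (by positivity)
  refine ⟨Metric.ball l (ε / 2), ?_, fun y hy z hz => ?_⟩
  · rw [mem_map]
    filter_upwards [hfg, hg.eventually (Metric.ball_mem_nhds l (show 0 < ε / 4 by positivity))]
      with r h1 h2
    rw [Set.mem_preimage, Metric.mem_ball]
    have h2 : dist (g r) l < ε / 4 := h2
    calc dist (f r) l ≤ dist (f r) (g r) + dist (g r) l := dist_triangle _ _ _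
      _ < ε / 4 + ε / 4 := add_lt_add_of_le_of_lt (by rwa [dist_eq_norm]) h2
      _ = ε / 2 := by ring
  · calc dist y z ≤ dist y l + dist z l := dist_triangle_right _ _ _
      _ < ε / 2 + ε / 2 := add_lt_add hy hz
      _ = ε := by ring

/-- In use, `D` is the event of return to the small disk, `E` the rare excursion, and `η` the
discrepancy of phases off `E`. -/
theorem norm_integral_le_of_norm_le_off_set {X : Type*} [MeasurableSpace X] {P : Measure X}
    {f : X → ℂ} {D E : Set X} {η e d : ℝ} (hD : NullMeasurableSet D P) (hη : 0 ≤ η) (he : 0 ≤ e)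
    (hd : 0 ≤ d) (hPE : P E ≤ ENNReal.ofReal e) (hPD : P D ≤ ENNReal.ofReal d)
    (h2 : ∀ ω, ‖f ω‖ ≤ 2) (h0 : ∀ ω ∉ D, f ω = 0)
    (h : ∀ᵐ ω ∂P, ω ∈ D → ω ∉ E → ‖f ω‖ ≤ η) : ‖∫ ω, f ω ∂P‖ ≤ 2 * e + η * d := by
  have key : ∫⁻ ω, ENNReal.ofReal ‖f ω‖ ∂P ≤ ENNReal.ofReal (2 * e + η * d) := by
    calc ∫⁻ ω, ENNReal.ofReal ‖f ω‖ ∂P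
        ≤ ∫⁻ ω, (D.indicator (fun _ => ENNReal.ofReal η) ω +
            E.indicator (fun _ => ENNReal.ofReal 2) ω) ∂P := by
          refine lintegral_mono_ae ?_
          filter_upwards [h] with ω hω
          by_cases h1 : ω ∈ D
          · by_cases h3 : ω ∈ E
            · rw [Set.indicator_of_mem h3]
              exact (ENNReal.ofReal_le_ofReal (h2 ω)).trans le_add_self
            · rw [Set.indicator_of_mem h1]
              exact (ENNReal.ofReal_le_ofReal (hω h1 h3)).trans le_self_add
          · simp [h0 ω h1]
      _ = ∫⁻ ω, D.indicator (fun _ => ENNReal.ofReal η) ω ∂P +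
            ∫⁻ ω, E.indicator (fun _ => ENNReal.ofReal 2) ω ∂P :=
          lintegral_add_left' (aemeasurable_const.indicator₀ hD) _
      _ ≤ ENNReal.ofReal η * P D + ENNReal.ofReal 2 * P E :=
          add_le_add (lintegral_indicator_const_le _ _) (lintegral_indicator_const_le _ _)
      _ ≤ ENNReal.ofReal η * ENNReal.ofReal d + ENNReal.ofReal 2 * ENNReal.ofReal e := by gcongr
      _ = ENNReal.ofReal (2 * e + η * d) := by
          rw [← ENNReal.ofReal_mul hη, ← ENNReal.ofReal_mul zero_le_two,
            ← ENNReal.ofReal_add (by positivity) (by positivity), add_comm]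
  exact (norm_integral_le_lintegral_norm f).trans
    (ENNReal.toReal_le_of_le_ofReal (by positivity) key)

/-- During `[u, t]` the path stays in a disk contained in `Ω`, hence free of marked points: it
cannot exit, and its monodromy depends only on its endpoints. -/
theorem pathPhase_eq_mul {γ : ℝ≥0 → ℂ} (hγ : Continuous γ) {Ω : Set ℂ} {S : Finset ℂ}
    (hS : (S : Set ℂ) ⊆ Ωᶜ) {x : ℂ} {u t : ℝ≥0} {ρ : ℝ} (hut : u ≤ t) (hρ : Metric.ball x ρ ⊆ Ω)
    (hx : ∀ s ∈ Set.Icc u t, γ s ∈ Metric.ball x ρ) :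
    pathPhase Ω S t γ =
      pathPhase Ω S u γ * (halfAnglePhase S x (γ t) / halfAnglePhase S x (γ u)) := by
  have hiff : (∀ s ≤ t, γ s ∈ Ω) ↔ ∀ s ≤ u, γ s ∈ Ω := by
    refine ⟨fun h s hs => h s (hs.trans hut), fun h s hs => ?_⟩
    rcases le_total s u with h' | h'
    · exact h s h'
    · exact hρ (hx s ⟨h', hs⟩)
  by_cases hin : ∀ s ≤ u, γ s ∈ Ω
  · have hin' := hiff.2 hin
    rw [pathPhase, pathPhase, if_pos hin, if_pos hin']
    refine exp_totalWinding_eq hγ hut (fun σ hσ s hs e => hS hσ (e ▸ hin' s hs))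
      fun σ hσ s hs => ?_
    have h1 : ρ ≤ ‖x - σ‖ := by
      by_contra hlt
      refine hS hσ (hρ ?_)
      rw [mem_ball_iff_norm, norm_sub_rev]
      exact not_le.1 hlt
    exact (mem_ball_iff_norm.1 (hx s hs)).trans_le h1
  · rw [pathPhase, pathPhase, if_neg hin, if_neg (mt hiff.1 hin), zero_mul]

/-- The path never leaves a disk missing `S \ T`, so those points contribute only through its
endpoints, and the initial one, `x`, has phase `1`. -/
theorem exp_totalWinding_eq_inter_mul {γ : ℝ≥0 → ℂ} (hγ : Continuous γ) {S T : Finset ℂ} {x : ℂ}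
    {t : ℝ≥0} {R : ℝ} (h0 : γ 0 = x) (hR : ∀ σ ∈ S \ T, R ≤ ‖x - σ‖)
    (hx : ∀ s ≤ t, ‖γ s - x‖ < R) :
    Complex.exp (Complex.I * Real.pi * totalWinding γ S t) =
      Complex.exp (Complex.I * Real.pi * totalWinding γ (S ∩ T) t) *
        halfAnglePhase (S \ T) x (γ t) := by
  have hsum : totalWinding γ S t = totalWinding γ (S ∩ T) t + totalWinding γ (S \ T) t :=
    (Finset.sum_inter_add_sum_sdiff S T _).symm
  have h1 := exp_totalWinding_eq hγ (S := S \ T) (x := x) (zero_le : 0 ≤ t)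
    (fun σ hσ s hs e => by
      have := (hx s hs).trans_le (hR σ hσ)
      rw [e, norm_sub_rev] at this
      exact lt_irrefl _ this)
    (fun σ hσ s hs => (hx s hs.2).trans_le (hR σ hσ))
  rw [totalWinding_zero, h0, halfAnglePhase_self] at h1
  rw [hsum, Complex.ofReal_add, mul_add, Complex.exp_add, h1]
  simp

/-! ### Existence of the limit and the Gaussian comparison. -/

section
variable {X : Type*} [MeasurableSpace X] {P : Measure X} {W : ℝ≥0 → X → ℂ} {x : ℂ}

namespace IsPlanarBrownian

theorem nullMeasurableSet_norm_sub_le (hW : IsPlanarBrownian W x P) (t : ℝ≥0) (r : ℝ) :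
    NullMeasurableSet {ω | ‖W t ω - x‖ ≤ r} P :=
  nullMeasurableSet_le ((hW.aemeasurable t).sub_const x).norm aemeasurable_const

theorem measure_norm_sub_le (hW : IsPlanarBrownian W x P) {t : ℝ≥0} (ht : 0 < t) {r : ℝ}
    (hr : 0 ≤ r) : P {ω | ‖W t ω - x‖ ≤ r} ≤ ENNReal.ofReal (r ^ 2 / (4 * t)) := by
  have := hW.isProbabilityMeasure
  simpa using hW.measure_norm_sub_le_inter ht MeasurableSet.univ hr

theorem measure_norm_sub_le_inter_exists (hW : IsPlanarBrownian W x P) {u t : ℝ≥0} (hu : 0 < u)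
    (hut : u < t) {b r : ℝ} (hb : 0 < b) (hr : 0 ≤ r) :
    P {ω | ‖W t ω - x‖ ≤ r ∧ ∃ q, b < ‖pathSample u (fun s => W s ω) q - x‖} ≤
      ENNReal.ofReal (r ^ 2 / (t - u) * Real.exp (-(b ^ 2 / (8 * u)))) := by
  have hM : MeasurableSet {p : ℚ≥0 → ℂ | ∃ q, b < ‖p q - x‖} := by
    have e : {p : ℚ≥0 → ℂ | ∃ q, b < ‖p q - x‖} = ⋃ q, {p | b < ‖p q - x‖} := by
      ext; simp
    rw [e]
    exact MeasurableSet.iUnion fun q => measurableSet_lt measurable_const (by fun_prop)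
  have hd : (0 : ℝ) < t - u := sub_pos.2 (by exact_mod_cast hut)
  refine (hW.measure_norm_sub_le_inter hut hM hr).trans ?_
  refine (mul_le_mul_right (hW.measure_exists_lt_norm_le hb hu) _).trans (le_of_eq ?_)
  rw [← ENNReal.ofReal_mul (by positivity)]
  congr 1
  field_simp

/-- Almost surely the reversed motion is at `W t` at time `t`, so the return event is unchanged and
late excursions become early ones. -/
theorem measure_norm_sub_le_inter_exists_reverse (hW : IsPlanarBrownian W x P) {u t : ℝ≥0}
    (hu : 0 < u) (hut : u < t) {b r : ℝ} (hb : 0 < b) (hr : 0 ≤ r) :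
    P {ω | ‖W t ω - x‖ ≤ r ∧
        ∃ q, b < ‖pathSample u (fun s => x + W (max s t) ω - W (t - s) ω) q - x‖} ≤
      ENNReal.ofReal (r ^ 2 / (t - u) * Real.exp (-(b ^ 2 / (8 * u)))) := by
  refine le_trans (measure_mono_ae ?_)
    ((hW.reverse t).measure_norm_sub_le_inter_exists hu hut hb hr)
  filter_upwards [hW.zero_ae] with ω h0
  rintro ⟨h1, h2⟩
  refine ⟨?_, h2⟩
  simpa [h0] using h1

theorem aestronglyMeasurable_pathPhase (hW : IsPlanarBrownian W x P) {Ω : Set ℂ} (hΩ : IsOpen Ω)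
    {S : Finset ℂ} (hS : (S : Set ℂ) ⊆ Ωᶜ) (t : ℝ≥0) :
    AEStronglyMeasurable (fun ω => pathPhase Ω S t fun s => W s ω) P := by
  obtain ⟨Φ, hΦ, -, hΦe⟩ := exists_measurable_pathPhase_eq hΩ hS t
  have h : AEMeasurable (fun ω => Φ (pathSample t fun s => W s ω)) P :=
    hΦ.comp_aemeasurable (hW.aemeasurable_pathSample t)
  refine AEMeasurable.aestronglyMeasurable (h.congr ?_)
  filter_upwards [hW.continuous_ae] with ω hω
  exact hΦe _ hω

theorem integrable_ite (hW : IsPlanarBrownian W x P) {t : ℝ≥0} {r : ℝ} {f : X → ℂ}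
    (hf : AEStronglyMeasurable f P) (hf1 : ∀ ω, ‖f ω‖ ≤ 1) :
    Integrable (fun ω => if ‖W t ω - x‖ ≤ r then f ω else 0) P := by
  have := hW.isProbabilityMeasure
  have h := (Integrable.of_bound hf 1 (Eventually.of_forall hf1)).indicator₀
    (hW.nullMeasurableSet_norm_sub_le t r)
  refine h.congr (Eventually.of_forall fun ω => ?_)
  by_cases hω : ‖W t ω - x‖ ≤ r
  · rw [Set.indicator_of_mem (by exact hω)]
    exact (if_pos hω).symm
  · rw [Set.indicator_of_notMem (by exact hω)]
    exact (if_neg hω).symm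

theorem heatKernelAverage_eq (hW : IsPlanarBrownian W x P) {Ω : Set ℂ} (hΩ : IsOpen Ω)
    (S : Finset ℂ) (t : ℝ≥0) (r : ℝ) :
    heatKernelAverage W P Ω S x t r = ((1 / (Real.pi * r ^ 2) : ℝ) : ℂ) *
      ∫ ω, (if ‖W t ω - x‖ ≤ r then pathPhase Ω S t fun s => W s ω else 0) ∂P := by
  rw [heatKernelAverage]
  congr 1
  refine integral_congr_ae ?_
  filter_upwards [hW.continuous_ae] with ω hω
  have h := lt_exitTime_iff hω hΩ t
  by_cases h1 : ‖W t ω - x‖ ≤ r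
  · by_cases h2 : ∀ s ≤ t, W s ω ∈ Ω
    · rw [if_pos ⟨h1, h.2 h2⟩, if_pos h1, pathPhase, if_pos h2]
    · rw [if_neg fun hh => h2 (h.1 hh.2), if_pos h1, pathPhase, if_neg h2]
  · rw [if_neg fun hh => h1 hh.1, if_neg h1]

/-- The reversed path controls distances to `γ t`; passing to distances from `x` costs the extra
`r`. -/
theorem mem_of_reverse_pathSample {γ : ℝ≥0 → ℂ} (hγ : Continuous γ) {u t : ℝ≥0} {b r : ℝ}
    (hr : ‖γ t - x‖ ≤ r)
    (h : ¬ ∃ q, b < ‖pathSample u (fun s => x + γ (max s t) - γ (t - s)) q - x‖)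
    {s : ℝ≥0} (hs : s ∈ Set.Icc (t - u) t) : ‖γ s - x‖ ≤ b + r := by
  have hc : Continuous fun s => x + γ (max s t) - γ (t - s) := by fun_prop
  have h1 := mem_of_pathSample_mem hc (Metric.isClosed_closedBall (x := x) (ε := b))
    (fun q => mem_closedBall_iff_norm.2 (not_lt.1 fun hh => h ⟨q, hh⟩))
    (s := t - s) (tsub_le_iff_tsub_le.1 hs.1)
  rw [mem_closedBall_iff_norm, max_eq_right tsub_le_self, tsub_tsub_cancel_of_le hs.2] at h1
  calc ‖γ s - x‖ = ‖(γ t - x) - (x + γ t - γ s - x)‖ := by congr 1; ring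
    _ ≤ ‖γ t - x‖ + ‖x + γ t - γ s - x‖ := norm_sub_le _ _
    _ ≤ b + r := by linarith

theorem exists_tendsto_heatKernelAverage (hW : IsPlanarBrownian W x P) {Ω : Set ℂ}
    (hΩ : IsOpen Ω) {S : Finset ℂ} (hS : (S : Set ℂ) ⊆ Ωᶜ) (hx : x ∈ Ω) {t : ℝ≥0} (ht : 0 < t) :
    ∃ l, Tendsto (heatKernelAverage W P Ω S x t) (𝓝[>] 0) (𝓝 l) := by
  refine exists_tendsto_of_approx fun ε hε => ?_
  obtain ⟨ρ, hρ, hball⟩ := Metric.isOpen_iff.1 hΩ x hx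
  have ht' : (0 : ℝ) < t := ht
  -- The second bound makes `8 * v / (ρ / 2)²`, which dominates the excursion factor `exp (-(ρ / 2)²
  -- / 8v)`, at most `ε * t / 8`.
  set v : ℝ≥0 := min (t / 2) (Real.toNNReal (ε * t * ρ ^ 2 / 256)) with hv
  have hv0 : 0 < v := lt_min (half_pos ht) (Real.toNNReal_pos.2 (by positivity))
  have hv0' : (0 : ℝ) < v := hv0
  have hv1 : (v : ℝ) ≤ t / 2 := by exact_mod_cast min_le_left (t / 2) _
  have hv2 : (v : ℝ) ≤ ε * t * ρ ^ 2 / 256 := by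
    have h : (v : ℝ) ≤ (Real.toNNReal (ε * t * ρ ^ 2 / 256) : ℝ) := by
      exact_mod_cast min_le_right (t / 2) _
    rwa [Real.coe_toNNReal _ (by positivity)] at h
  have hvt : v < t := lt_of_le_of_lt (min_le_left _ _) (half_lt_self ht)
  have hut : t - v < t := tsub_lt_self ht hv0
  obtain ⟨Φ, hΦ, hΦ1, hΦe⟩ := exists_measurable_pathPhase_eq hΩ hS (t - v)
  -- This is the phase at time `t` with its last factor `halfAnglePhase S x (W t)` replaced by `1`,
  -- its limit at `x`; what remains depends only on the path up to `t - v`.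
  let H : (ℚ≥0 → ℂ) → ℂ := fun p => Φ p / halfAnglePhase S x (p (⌈t - v⌉₊ : ℚ≥0))
  have hH : Measurable H :=
    hΦ.div ((measurable_halfAnglePhase S x).comp (measurable_pi_apply _))
  have hH1 : ∀ p, ‖H p‖ ≤ 1 := by
    intro p
    simp only [H, norm_div, norm_halfAnglePhase, div_one]
    exact hΦ1 p
  obtain ⟨l, hl⟩ := hW.tendsto_average_pathSample hut hH hH1
  refine ⟨_, l, hl, ?_⟩
  have hxS : x ∉ S := fun h => hS h hx
  obtain ⟨δ, hδ, hδ'⟩ := Metric.tendsto_nhds_nhds.1 (tendsto_halfAnglePhase hxS) (ε * t)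
    (by positivity)
  have hexp : Real.exp (-((ρ / 2) ^ 2 / (8 * v))) ≤ ε * t / 8 := by
    have h1 : 0 < (ρ / 2) ^ 2 / (8 * v) := by positivity
    have h2 : (ρ / 2) ^ 2 / (8 * v) ≤ Real.exp ((ρ / 2) ^ 2 / (8 * v)) :=
      (by linarith : _ ≤ (ρ / 2) ^ 2 / (8 * (v : ℝ)) + 1).trans (Real.add_one_le_exp _)
    rw [Real.exp_neg]
    refine (inv_anti₀ h1 h2).trans ?_
    rw [inv_div, div_le_iff₀ (by positivity)]
    calc 8 * (v : ℝ) ≤ 8 * (ε * t * ρ ^ 2 / 256) := by gcongr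
      _ = ε * t / 8 * (ρ / 2) ^ 2 := by ring
  filter_upwards [Ioo_mem_nhdsGT (lt_min hδ (half_pos hρ))] with r hr
  have hr0 : 0 < r := hr.1
  have hrδ : r < δ := hr.2.trans_le (min_le_left _ _)
  have hrρ : r < ρ / 2 := hr.2.trans_le (min_le_right _ _)
  have hHm : AEStronglyMeasurable (fun ω => H (pathSample (t - v) fun s => W s ω)) P :=
    (hH.comp_aemeasurable (hW.aemeasurable_pathSample (t - v))).aestronglyMeasurable
  rw [hW.heatKernelAverage_eq hΩ, ← mul_sub, ← integral_sub
    (hW.integrable_ite (hW.aestronglyMeasurable_pathPhase hΩ hS t) fun ω => norm_pathPhase_le _ _ _ _)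
    (hW.integrable_ite hHm fun ω => hH1 _)]
  have hmain := norm_integral_le_of_norm_le_off_set (P := P)
    (f := fun ω => (if ‖W t ω - x‖ ≤ r then pathPhase Ω S t fun s => W s ω else 0) -
      (if ‖W t ω - x‖ ≤ r then H (pathSample (t - v) fun s => W s ω) else 0))
    (hW.nullMeasurableSet_norm_sub_le t r) (η := ε * t) (by positivity)
    (by have : (0 : ℝ) ≤ t - v := by linarith
        positivity) (by positivity)
    (hW.measure_norm_sub_le_inter_exists_reverse hv0 hvt (half_pos hρ) hr0.le)
    (hW.measure_norm_sub_le ht hr0.le) ?_ ?_ ?_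
  · rw [norm_mul, Complex.norm_real, Real.norm_of_nonneg (by positivity)]
    have htv : (t : ℝ) / 2 ≤ t - v := by linarith
    have htv0 : (0 : ℝ) ≤ t - v := by linarith
    have hpi : (3 : ℝ) < Real.pi := Real.pi_gt_three
    calc 1 / (Real.pi * r ^ 2) * _
        ≤ 1 / (Real.pi * r ^ 2) * (2 * (r ^ 2 / (t - v) * Real.exp (-((ρ / 2) ^ 2 / (8 * v)))) +
          ε * t * (r ^ 2 / (4 * t))) := by gcongr
      _ ≤ 1 / (3 * r ^ 2) * (2 * (r ^ 2 / (t / 2) * (ε * t / 8)) +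
          ε * t * (r ^ 2 / (4 * t))) := by gcongr
      _ = ε / 4 := by field_simp; norm_num
      _ ≤ ε := by linarith
  · intro ω
    refine (norm_sub_le _ _).trans ?_
    have h1 : ‖(if ‖W t ω - x‖ ≤ r then pathPhase Ω S t fun s => W s ω else 0 : ℂ)‖ ≤ 1 := by
      split_ifs
      · exact norm_pathPhase_le _ _ _ _
      · simp
    have h2 : ‖(if ‖W t ω - x‖ ≤ r then H (pathSample (t - v) fun s => W s ω) else 0 : ℂ)‖ ≤ 1 := by
      split_ifs
      · exact hH1 _
      · simp
    linarith
  · intro ω hω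
    rw [if_neg (by exact hω), if_neg (by exact hω), sub_zero]
  · filter_upwards [hW.continuous_ae] with ω hc hD hE
    have hD' : ‖W t ω - x‖ ≤ r := hD
    have hE' := fun h => hE ⟨hD', h⟩
    rw [if_pos hD', if_pos hD']
    have hin : ∀ s ∈ Set.Icc (t - v) t, W s ω ∈ Metric.ball x ρ := fun s hs =>
      mem_ball_iff_norm.2 ((mem_of_reverse_pathSample hc hD' hE' hs).trans_lt (by linarith))
    have hone : halfAnglePhase S x (W (t - v) ω) ≠ 0 :=
      norm_ne_zero_iff.1 (by rw [norm_halfAnglePhase]; exact one_ne_zero)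
    have e : (pathPhase Ω S t fun s => W s ω) - H (pathSample (t - v) fun s => W s ω) =
        H (pathSample (t - v) fun s => W s ω) * (halfAnglePhase S x (W t ω) - 1) := by
      simp only [H, hΦe _ hc, pathSample_ceil]
      rw [pathPhase_eq_mul hc hS hut.le hball hin]
      field_simp
    rw [e, norm_mul]
    have h3 := hδ' (x := W t ω) (by rw [dist_eq_norm]; exact hD'.trans_lt hrδ)
    rw [dist_eq_norm] at h3
    calc _ ≤ 1 * ‖halfAnglePhase S x (W t ω) - 1‖ := by
          gcongr
          exact hH1 _
      _ ≤ ε * t := by rw [one_mul]; exact h3.le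

theorem norm_sub_le_of_tendsto_heatKernelAverage (hW : IsPlanarBrownian W x P) {Ω Θ : Set ℂ}
    (hΩ : IsOpen Ω) (hΘ : IsOpen Θ) {S₁ S₂ : Finset ℂ} (hS₁ : (S₁ : Set ℂ) ⊆ Ωᶜ)
    (hS₂ : (S₂ : Set ℂ) ⊆ Θᶜ) (hx : x ∈ Ω ∩ Θ) {t : ℝ≥0} (ht : 0 < t) {R : ℝ} (hR : 0 < R)
    (hΩΘ : ∀ y, ‖y - x‖ < R → (y ∈ Ω ↔ y ∈ Θ)) (h₁₂ : ∀ σ ∈ S₁ \ S₂, R ≤ ‖x - σ‖)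
    (h₂₁ : ∀ σ ∈ S₂ \ S₁, R ≤ ‖x - σ‖) {l₁ l₂ : ℂ}
    (hl₁ : Tendsto (heatKernelAverage W P Ω S₁ x t) (𝓝[>] 0) (𝓝 l₁))
    (hl₂ : Tendsto (heatKernelAverage W P Θ S₂ x t) (𝓝[>] 0) (𝓝 l₂)) :
    ‖l₁ - l₂‖ ≤ 8 / t * Real.exp (-R ^ 2 / (8 * t)) := by
  refine le_of_forall_pos_le_add fun ε hε => ?_
  refine le_of_tendsto (hl₁.sub hl₂).norm ?_
  have ht' : (0 : ℝ) < t := ht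
  have hlim : Tendsto (fun z => halfAnglePhase (S₁ \ S₂) x z - halfAnglePhase (S₂ \ S₁) x z) (𝓝 x)
      (𝓝 (1 - 1)) :=
    (tendsto_halfAnglePhase fun h => hS₁ (Finset.mem_sdiff.1 h).1 hx.1).sub
      (tendsto_halfAnglePhase fun h => hS₂ (Finset.mem_sdiff.1 h).1 hx.2)
  obtain ⟨δ, hδ, hδ'⟩ := Metric.tendsto_nhds_nhds.1 hlim (ε * t) (by positivity)
  -- The radius is shrunk to `3R/4` to leave room for `r < R/4` under reversal. Halving the time
  -- pays for it: the exponent becomes `9R² / 64t ≥ R² / 8t`.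
  have hexp : Real.exp (-((3 * R / 4) ^ 2 / (8 * (t / 2 : ℝ≥0)))) ≤ Real.exp (-R ^ 2 / (8 * t)) := by
    refine Real.exp_le_exp.2 ?_
    push_cast
    rw [← neg_div, div_le_div_iff₀ (by positivity) (by positivity)]
    have : 0 < R ^ 2 * t := by positivity
    nlinarith
  have hhalf : (0 : ℝ≥0) < t / 2 := half_pos ht
  have hhalf' : t / 2 < t := half_lt_self ht
  have hb : 0 < 3 * R / 4 := by positivity
  filter_upwards [Ioo_mem_nhdsGT (lt_min hδ (show 0 < R / 4 by positivity))] with r hr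
  have hr0 : 0 < r := hr.1
  have hrδ : r < δ := hr.2.trans_le (min_le_left _ _)
  have hrR : r < R / 4 := hr.2.trans_le (min_le_right _ _)
  have hE1 := hW.measure_norm_sub_le_inter_exists hhalf hhalf' hb hr0.le
  have hE2 := hW.measure_norm_sub_le_inter_exists_reverse hhalf hhalf' hb hr0.le
  have hE3 := (measure_union_le (μ := P) _ _).trans (add_le_add hE1 hE2)
  have hden : (0 : ℝ) ≤ r ^ 2 / (t - (t / 2 : ℝ≥0)) := by
    have : (0 : ℝ) ≤ t - (t / 2 : ℝ≥0) := by push_cast; linarith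
    positivity
  rw [← ENNReal.ofReal_add (mul_nonneg hden (Real.exp_pos _).le)
    (mul_nonneg hden (Real.exp_pos _).le)] at hE3
  rw [hW.heatKernelAverage_eq hΩ, hW.heatKernelAverage_eq hΘ, ← mul_sub, ← integral_sub
    (hW.integrable_ite (hW.aestronglyMeasurable_pathPhase hΩ hS₁ t)
      fun ω => norm_pathPhase_le _ _ _ _)
    (hW.integrable_ite (hW.aestronglyMeasurable_pathPhase hΘ hS₂ t)
      fun ω => norm_pathPhase_le _ _ _ _)]
  have hmain := norm_integral_le_of_norm_le_off_set (P := P)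
    (f := fun ω => (if ‖W t ω - x‖ ≤ r then pathPhase Ω S₁ t fun s => W s ω else 0) -
      (if ‖W t ω - x‖ ≤ r then pathPhase Θ S₂ t fun s => W s ω else 0))
    (hW.nullMeasurableSet_norm_sub_le t r) (η := ε * t) (by positivity)
    (by positivity) (by positivity) hE3 (hW.measure_norm_sub_le ht hr0.le) ?_ ?_ ?_
  · rw [norm_mul, Complex.norm_real, Real.norm_of_nonneg (by positivity)]
    have hpi : (3 : ℝ) < Real.pi := Real.pi_gt_three
    have hth : (t : ℝ) - (t / 2 : ℝ≥0) = t / 2 := by push_cast; ring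
    rw [hth] at hmain
    set e := Real.exp (-R ^ 2 / (8 * t))
    have he : 0 < e := Real.exp_pos _
    calc 1 / (Real.pi * r ^ 2) * _
        ≤ 1 / (Real.pi * r ^ 2) * _ := mul_le_mul_of_nonneg_left hmain (by positivity)
      _ ≤ 1 / (3 * r ^ 2) * (2 * (r ^ 2 / (t / 2) * e + r ^ 2 / (t / 2) * e) +
          ε * t * (r ^ 2 / (4 * t))) := by gcongr
      _ = 8 / 3 / t * e + ε / 12 := by field_simp; ring
      _ ≤ 8 / t * e + ε := by
          have : 8 / 3 / (t : ℝ) * e ≤ 8 / t * e := by gcongr; norm_num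
          linarith
  · intro ω
    refine (norm_sub_le _ _).trans ?_
    have h1 : ∀ (U : Set ℂ) (S : Finset ℂ),
        ‖(if ‖W t ω - x‖ ≤ r then pathPhase U S t fun s => W s ω else 0 : ℂ)‖ ≤ 1 := by
      intro U S
      split_ifs
      · exact norm_pathPhase_le _ _ _ _
      · simp
    linarith [h1 Ω S₁, h1 Θ S₂]
  · intro ω hω
    rw [if_neg (by exact hω), if_neg (by exact hω), sub_zero]
  · filter_upwards [hW.continuous_ae, hW.zero_ae] with ω hc h0 hD hE
    have hD' : ‖W t ω - x‖ ≤ r := hD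
    have hE1' := fun h => hE (Or.inl ⟨hD', h⟩)
    have hE2' := fun h => hE (Or.inr ⟨hD', h⟩)
    rw [if_pos hD', if_pos hD']
    -- Off the two excursion events, the forward bound covers the first half of the time interval
    -- and the reversed bound the second.
    have hin : ∀ s ≤ t, ‖W s ω - x‖ < R := by
      intro s hs
      rcases le_total s (t / 2) with h | h
      · have h1 := mem_of_pathSample_mem hc
          (Metric.isClosed_closedBall (x := x) (ε := 3 * R / 4))
          (fun q => mem_closedBall_iff_norm.2 (not_lt.1 fun hh => hE1' ⟨q, hh⟩)) h
        rw [mem_closedBall_iff_norm] at h1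
        linarith
      · have h2 : t - t / 2 ≤ s := tsub_le_iff_right.2 (by
          calc t = t / 2 + t / 2 := (add_halves t).symm
            _ ≤ s + t / 2 := by gcongr)
        have h1 := mem_of_reverse_pathSample hc hD' hE2' ⟨h2, hs⟩
        linarith
    have hiff : (∀ s ≤ t, W s ω ∈ Ω) ↔ ∀ s ≤ t, W s ω ∈ Θ :=
      forall₂_congr fun s hs => hΩΘ _ (hin s hs)
    by_cases hstay : ∀ s ≤ t, W s ω ∈ Ω
    · rw [pathPhase, pathPhase, if_pos hstay, if_pos (hiff.1 hstay),
        exp_totalWinding_eq_inter_mul (T := S₂) hc h0 h₁₂ hin,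
        exp_totalWinding_eq_inter_mul (T := S₁) hc h0 h₂₁ hin, Finset.inter_comm S₂ S₁, ← mul_sub,
        norm_mul, norm_exp_totalWinding, one_mul]
      have h3 := hδ' (x := W t ω) (by rw [dist_eq_norm]; exact hD'.trans_lt hrδ)
      rw [sub_self, dist_zero_right] at h3
      exact h3.le
    · rw [pathPhase, pathPhase, if_neg hstay, if_neg (mt hiff.2 hstay), sub_zero, norm_zero]
      positivity

end IsPlanarBrownian

end

/-! ### The comparison in terms of the distance to the symmetric differences. -/

theorem mainTheorem4 :
    ∃ C : ℝ, 0 < C ∧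
      ∀ {X : Type*} [MeasurableSpace X] (P : Measure X) [IsProbabilityMeasure P]
        (W : ℝ≥0 → X → ℂ) (x : ℂ) (_ : IsPlanarBrownian W x P)
        (Ω Θ : Set ℂ) (_ : IsOpen Ω) (_ : IsOpen Θ)
        (S₁ S₂ : Finset ℂ) (_ : (S₁ : Set ℂ) ⊆ Ωᶜ) (_ : (S₂ : Set ℂ) ⊆ Θᶜ)
        (_ : x ∈ Ω ∩ Θ) (t : ℝ≥0) (_ : 0 < t),
        Tendsto (heatKernelAverage W P Ω S₁ x t) (𝓝[>] 0)
            (𝓝 (dirichletHeatKernelDiag W P Ω S₁ x t)) ∧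
          Tendsto (heatKernelAverage W P Θ S₂ x t) (𝓝[>] 0)
            (𝓝 (dirichletHeatKernelDiag W P Θ S₂ x t)) ∧
          ‖dirichletHeatKernelDiag W P Ω S₁ x t - dirichletHeatKernelDiag W P Θ S₂ x t‖ ≤
            C / t * gaussianFactor
              (Metric.infEDist x (symmDiff Θ Ω ∪ symmDiff (S₁ : Set ℂ) (S₂ : Set ℂ))) t := by
  refine ⟨8, by norm_num, ?_⟩
  intro X _ P _ W x hW Ω Θ hΩ hΘ S₁ S₂ hS₁ hS₂ hx t ht
  have hl₁ := tendsto_nhds_limUnder (hW.exists_tendsto_heatKernelAverage hΩ hS₁ hx.1 ht)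
  have hl₂ := tendsto_nhds_limUnder (hW.exists_tendsto_heatKernelAverage hΘ hS₂ hx.2 ht)
  refine ⟨hl₁, hl₂, ?_⟩
  set A : Set ℂ := symmDiff Θ Ω ∪ symmDiff (S₁ : Set ℂ) (S₂ : Set ℂ) with hA
  -- Infinite distance means that `A` is empty, so the two domains and the two sets of marked points
  -- coincide.
  by_cases htop : Metric.infEDist x A = ⊤
  · have hempty : A = ∅ := by
      by_contra hne
      exact Metric.infEDist_ne_top (Set.nonempty_iff_ne_empty.2 hne) htop
    obtain ⟨h1, h2⟩ := Set.union_empty_iff.1 hempty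
    have e1 : Θ = Ω := symmDiff_eq_bot.1 h1
    have e2 : S₁ = S₂ := Finset.coe_injective (symmDiff_eq_bot.1 h2)
    subst e1 e2
    rw [sub_self, norm_zero, gaussianFactor, if_pos htop, mul_zero]
  · rw [gaussianFactor, if_neg htop]
    have hlow : ∀ y, ENNReal.ofReal ‖y - x‖ < Metric.infEDist x A → y ∉ A := by
      intro y hy hyA
      have h := Metric.infEDist_le_edist_of_mem (x := x) hyA
      rw [edist_comm, edist_dist, dist_eq_norm] at h
      exact absurd hy (not_lt.2 h)
    have hlow' : ∀ y, ‖y - x‖ < (Metric.infEDist x A).toReal → y ∉ A := by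
      intro y hy
      refine hlow y ?_
      rw [← ENNReal.ofReal_toReal htop]
      exact (ENNReal.ofReal_lt_ofReal_iff ((norm_nonneg _).trans_lt hy)).2 hy
    -- A disk about `x` inside `Ω ∩ Θ` meets neither symmetric difference, since the marked points
    -- lie outside `Ω` or outside `Θ`.
    have hpos : 0 < (Metric.infEDist x A).toReal := by
      refine ENNReal.toReal_pos ?_ htop
      obtain ⟨δ, hδ, hball⟩ := Metric.isOpen_iff.1 (hΩ.inter hΘ) x hx
      have h1 : ENNReal.ofReal δ ≤ Metric.infEDist x A := by
        rw [Metric.le_infEDist]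
        intro y hy
        by_contra hlt
        rw [not_le, edist_dist, ENNReal.ofReal_lt_ofReal_iff hδ, dist_comm] at hlt
        obtain ⟨k1, k2⟩ := hball (Metric.mem_ball.2 hlt)
        rcases hy with (⟨-, h⟩ | ⟨-, h⟩) | (⟨h, -⟩ | ⟨h, -⟩)
        · exact h k1
        · exact h k2
        · exact hS₁ h k1
        · exact hS₂ h k2
      exact ((ENNReal.ofReal_pos.2 hδ).trans_le h1).ne'
    refine hW.norm_sub_le_of_tendsto_heatKernelAverage hΩ hΘ hS₁ hS₂ hx ht hpos
      (fun y hy => ?_) (fun σ hσ => ?_) (fun σ hσ => ?_) hl₁ hl₂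
    · have h := hlow' y hy
      constructor
      · intro h1
        by_contra h2
        exact h (Or.inl (Or.inr ⟨h1, h2⟩))
      · intro h1
        by_contra h2
        exact h (Or.inl (Or.inl ⟨h1, h2⟩))
    · rw [norm_sub_rev]
      by_contra hlt
      have h := Finset.mem_sdiff.1 hσ
      exact hlow' σ (not_le.1 hlt) (Or.inr (Or.inl ⟨h.1, h.2⟩))
    · rw [norm_sub_rev]
      by_contra hlt
      have h := Finset.mem_sdiff.1 hσ
      exact hlow' σ (not_le.1 hlt) (Or.inr (Or.inr ⟨h.1, h.2⟩))
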